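/- **Signatures and formulas.** Let $\sigma=(\mathrm{Dom},\mathrm{Ran})$ be a finite signature: $\mathrm{Dom}$ is a nonempty finite set of variables and each $\mathrm{Ran}(X)$ is a nonempty finite set of values. An equation $\mathbf X=\mathbf x$ is a finite conjunction $X_1=x_1\wedge\dots\wedge X_n=x_n$ with $x_i\in\mathrm{Ran}(X_i)$, taken up to the order of its conjuncts; it is inconsistent if it contains $X=x$ and $X=x'$ with $x\ne x'$. The languages are $$\mathcal{CO}[\sigma]:\ \alpha::=X=x\mid\neg\alpha\mid\alpha\wedge\alpha\mid\alpha\vee\alpha\mid\mathbf X=\mathbf x\,\Box\!\!\to\alpha,$$ $$\mathcal{COD}[\sigma]:\ \varphi::=X=x\mid{=}(\mathbf X;Y)\mid\neg\alpha\mid\varphi\wedge\varphi\mid\varphi\vee\varphi\mid\mathbf X=\mathbf x\,\Box\!\!\to\varphi ,$$ where $\alpha\in\mathcal{CO}[\sigma]$ and antecedents are nonempty; with an empty antecedent, $\mathbf X=\mathbf x\,\Box\!\!\to\varphi$ denotes $\varphi$ itself. Abbreviations: $\bot$ is $X=x\wedge\neg X=x$, ${=}(Y)$ is the dependence atom with empty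 first component, $\alpha\supset\varphi$ is $\neg\alpha\vee\varphi$; the empty disjunction is $\bot$, the empty conjunction is $\neg\bot$. **Semantics.** A system of functions $\mathcal F$ assigns to each $V$ in a set $\mathrm{En}(\mathcal F)\subseteq\mathrm{Dom}$ a set $PA_V\subseteq\mathrm{Dom}\setminus\{V\}$ and a function $\mathcal F_V:\mathrm{Ran}(PA_V)\to\mathrm{Ran}(V)$; it is recursive if the graph with edges $(X,V)$, $X\in PA_V$, is acyclic. All systems below are recursive. An assignment $s$ (with $s(X)\in\mathrm{Ran}(X)$) is compatible with $\mathcal F$ if $s(V)=\mathcal F_V(s(PA_V))$ for all $V\in\mathrm{En}(\mathcal F)$. A causal team is a pair $T=(T^-,\mathcal F)$ with $T^-$ a set of assignments compatible with $\mathcal F$. A generalized causal team is a subset of the set $\mathbb{S}\mathrm{em}_\sigma$ of all pairs $(s,\mathcal F)$ with $s$ compatible with $\mathcal F$. For a consistent $\mathbf X=\mathbf x$, $\mathcal F_{\mathbf X=\mathbf x}$ is the restriction of $\mathcal F$ to $\mathrm{En}(\mathcal F)\setminus\mathbf X$, and $s_{\mathbf X=\mathbf x}$ is given recursively by $s_{\mathbf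 X=\mathbf x}(X_i)=x_i$, $s_{\mathbf X=\mathbf x}(V)=s(V)$ for $V\notin\mathrm{En}(\mathcal F)\cup\mathbf X$, and $s_{\mathbf X=\mathbf x}(V)=\mathcal F_V(s_{\mathbf X=\mathbf x}(PA_V))$ for $V\in\mathrm{En}(\mathcal F)\setminus\mathbf X$; $T_{\mathbf X=\mathbf x}$ is obtained by applying this to the function component(s) and to every assignment of $T$. Satisfaction: $T\models X=x$ iff $s(X)=x$ for every assignment $s$ of $T$; $T\models{=}(\mathbf X;Y)$ iff any two assignments of $T$ that agree on $\mathbf X$ agree on $Y$; $T\models\neg\alpha$ iff no one-element subteam of $T$ satisfies $\alpha$; $\wedge$ is conjunction; $T\models\varphi\vee\psi$ iff $T=T_1\cup T_2$ for some subteams (with the same $\mathcal F$, in the case of causal teams) with $T_1\models\varphi$, $T_2\models\psi$; $T\models\mathbf X=\mathbf x\,\Box\!\!\to\varphi$ iff $\mathbf X=\mathbf x$ is inconsistent or $T_{\mathbf X=\mathbf x}\models\varphi$. Write $\Gamma\models^{c}\psi$ (resp. $\Gamma\models^{g}\psi$) if every causal team (resp. generalized causal team) that satisfies all of $\Gamma$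 satisfies $\psi$. **The system $\vdash^g$.** Natural deduction with the following rules, where $\alpha$ ranges over $\mathcal{CO}[\sigma]$, other Greek letters over $\mathcal{COD}[\sigma]$, and equations $\mathbf X=\mathbf x$, $\mathbf Y=\mathbf y$ may be empty. * ValDef: $\vdash\bigvee_{x\in\mathrm{Ran}(X)}X=x$. ValUnq: $X=x\vdash\neg X=x'$ for $x\neq x'$. * The usual introduction and elimination rules for $\wedge$, introduction rules for $\vee$; $\vee$-elimination with conclusion $\alpha$; $\neg$I: from a derivation of $\bot$ from $\alpha$ infer $\neg\alpha$; $\neg$E: $\alpha,\neg\alpha\vdash\varphi$; RAA: from a derivation of $\bot$ from $\neg\alpha$ infer $\alpha$. * $\vdash(\mathbf X=\mathbf x\wedge Y=y)\,\Box\!\!\to Y=y$. From $\mathbf X=\mathbf x\,\Box\!\!\to W=w$ and $\mathbf X=\mathbf x\,\Box\!\!\to\gamma$ infer $(\mathbf X=\mathbf x\wedge W=w)\,\Box\!\!\to\gamma$, for $\gamma$ without $\Box\!\!\to$. From $\mathbf X=\mathbf x\,\Box\!\!\to\bot$ with $\mathbf X=\mathbf x$ consistent infer $\varphi$. $\vdash(\mathbf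 Y=\mathbf y\wedge X=x\wedge X=x')\,\Box\!\!\to\varphi$ for $x\ne x'$. Contraction and duplication of a repeated conjunct of an antecedent. From $\mathbf X=\mathbf x\,\Box\!\!\to\varphi$ and a derivation of $\psi$ from $\varphi$ alone infer $\mathbf X=\mathbf x\,\Box\!\!\to\psi$. From $\mathbf X=\mathbf x\,\Box\!\!\to\varphi$ and $\mathbf X=\mathbf x\,\Box\!\!\to\psi$ infer $\mathbf X=\mathbf x\,\Box\!\!\to\varphi\wedge\psi$. $\mathbf X=\mathbf x\,\Box\!\!\to\varphi\vee\psi\dashv\vdash(\mathbf X=\mathbf x\,\Box\!\!\to\varphi)\vee(\mathbf X=\mathbf x\,\Box\!\!\to\psi)$. From $\mathbf X=\mathbf x\,\Box\!\!\to(\mathbf Y=\mathbf y\,\Box\!\!\to\varphi)$ with $\mathbf X=\mathbf x$ consistent infer $(\mathbf X'=\mathbf x'\wedge\mathbf Y=\mathbf y)\,\Box\!\!\to\varphi$, where $\mathbf X'=\mathbf x'$ consists of the conjuncts of $\mathbf X=\mathbf x$ with variable not in $\mathbf Y$. From $(\mathbf X=\mathbf x\wedge\mathbf Y=\mathbf y)\,\Box\!\!\to\varphi$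 with $\mathbf X\cap\mathbf Y=\emptyset$ infer $\mathbf X=\mathbf x\,\Box\!\!\to(\mathbf Y=\mathbf y\,\Box\!\!\to\varphi)$. From $\neg(\mathbf X=\mathbf x\,\Box\!\!\to\alpha)$ infer $\mathbf X=\mathbf x\,\Box\!\!\to\neg\alpha$. Recur: from $X_1\leadsto X_2,\dots,X_{k-1}\leadsto X_k$ infer $\neg(X_k\leadsto X_1)$, for distinct $X_1,\dots,X_k$, $k\ge2$, where $X\leadsto Y$ is the disjunction of all $\mathbf Z=\mathbf z\,\Box\!\!\to((X=x\,\Box\!\!\to Y=y)\wedge(X=x'\,\Box\!\!\to Y=y'))$ with $\mathbf Z\subseteq\mathrm{Dom}\setminus\{X,Y\}$, $\mathbf z\in\mathrm{Ran}(\mathbf Z)$, $x\neq x'$, $y\neq y'$. * $\vee$Com: $\varphi\vee\psi\vdash\psi\vee\varphi$. $\vee$Ass: $(\varphi\vee\psi)\vee\chi\vdash\varphi\vee(\psi\vee\chi)$. $\vee$Sub: from $\varphi\vee\psi$ and a derivation of $\chi$ from $\varphi$ infer $\chi\vee\psi$. * DepI$_0$: $X=x\vdash{=}(X)$. DepI: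 from a derivation of ${=}(Y)$ from ${=}(X_1),\dots,{=}(X_n)$ infer ${=}(X_1,\dots,X_n;Y)$. Dep$_0$E: from $\varphi$ and, for each $x\in\mathrm{Ran}(X)$, a derivation of $\psi$ from the formula obtained from $\varphi$ by replacing one specific occurrence of ${=}(X)$ by $X=x$, infer $\psi$. DepE: ${=}(X_1,\dots,X_n;Y),{=}(X_1),\dots,{=}(X_n)\vdash{=}(Y)$. Derivations from assumptions may use further open assumptions wherever it is not said otherwise. **The system $\vdash^c$.** This is $\vdash^g$ with two further axioms. Let $\mathbf W_V=\mathrm{Dom}\setminus\{V\}$, and let $\beta_{\mathrm{En}}(V)$ be the disjunction, over $X\in\mathbf W_V$, $\mathbf Z=\mathrm{Dom}\setminus\{X,V\}$, $\mathbf z\in\mathrm{Ran}(\mathbf Z)$, $x\ne x'$ in $\mathrm{Ran}(X)$, $v\neq v'$ in $\mathrm{Ran}(V)$, of $((\mathbf Z=\mathbf z\wedge X=x)\,\Box\!\!\to V=v)\wedge((\mathbf Z=\mathbf z\wedge X=x')\,\Box\!\!\to V=v')$. Then $$\mathsf{1Fun}:\ \bigwedge_{V\in\mathrm{Dom}}\Big(\beta_{\mathrm{En}}(V)\supset\bigwedge_{\mathbf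 w\in\mathrm{Ran}(\mathbf W_V)}(\mathbf W_V=\mathbf w\,\Box\!\!\to{=}(V))\Big),$$ $$\mathsf{NoMix}:\ \bigwedge_{V\in\mathrm{Dom}}\bigwedge\{\Xi_*^{\{a,b\}}\mid a,b\in\mathbb{S}\mathrm{em}_\sigma,\ \{a\}\models\beta_{\mathrm{En}}(V),\ \{b\}\not\models\beta_{\mathrm{En}}(V)\},$$ where $\Xi_*^{\{a,b\}}$ is $\chi_1\vee\Theta$ with $$\chi_1=\bigwedge_{V}\Big({=}(V)\wedge\bigwedge_{\mathbf w}(\mathbf W_V=\mathbf w\,\Box\!\!\to{=}(V))\Big),\qquad \Theta=\bigvee\Big\{\bigwedge_V V=s(V)\wedge\Phi^{\mathcal F}\ \Big|\ (s,\mathcal F)\in\mathbb{S}\mathrm{em}_\sigma,\ (s,\mathcal F)\not\approx a,\ (s,\mathcal F)\not\approx b\Big\}.$$ Here $(s,\mathcal F)\approx(t,\mathcal G)$ means $s=t$ and $\mathcal F\sim\mathcal G$, i.e. $\mathcal F$ and $\mathcal G$ have the same endogenous variables with non-constant function, and for each of these $\mathcal F_V$ and $\mathcal G_V$ are equal up to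 dummy arguments; and $\Phi^{\mathcal F}$ is the conjunction of all $(\mathbf W=\mathbf w\wedge PA_V=\mathbf p)\,\Box\!\!\to V=\mathcal F_V(\mathbf p)$ with $V\in\mathrm{En}(\mathcal F)$, $\mathbf W=\mathrm{Dom}\setminus(PA_V\cup\{V\})$, $\mathbf w\in\mathrm{Ran}(\mathbf W)$, $\mathbf p\in\mathrm{Ran}(PA_V)$, and of all $V=v\supset(\mathbf W_V=\mathbf w\,\Box\!\!\to V=v)$ with $V$ exogenous or with $\mathcal F_V$ constant, $v\in\mathrm{Ran}(V)$, $\mathbf w\in\mathrm{Ran}(\mathbf W_V)$. **Theorem.** For every signature $\sigma$ and every set $\Gamma\cup\{\psi\}$ of $\mathcal{COD}[\sigma]$-formulas, $$\Gamma\vdash^{g}\psi\iff\Gamma\models^{g}\psi\qquad\text{and}\qquad\Gamma\vdash^{c}\psi\iff\Gamma\models^{c}\psi .$$ -/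

import Mathlib

universe u v

namespace CTeam

/-! ### Signatures, formulas -/

/-- A finite signature: a nonempty finite set of variables, each with a nonempty finite range. -/
structure Signature where
  Var : Type u
  Ran : Var → Type v
  finVar : Finite Var
  neVar : Nonempty Var
  finRan : ∀ X, Finite (Ran X)
  neRan : ∀ X, Nonempty (Ran X)

attribute [instance] Signature.finVar Signature.neVar Signature.finRan Signature.neRan

variable {σ : Signature.{u, v}}

/-- An equality `X = x` with `x ∈ Ran(X)`, as a piece of data. -/
abbrev Eqn (σ : Signature.{u, v}) := Σ X : σ.Var, σ.Ran X

/-- Formulas.  `Fml σ false` is the language `CO[σ]`, `Fml σ true` is the language `COD[σ]`;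
in both of them negation applies to `CO`-formulas only.  The antecedent of a counterfactual
is a nonempty finite conjunction of equalities, taken up to the order of the conjuncts. -/
inductive Fml (σ : Signature.{u, v}) : Bool → Type (max u v)
  | atom {b : Bool} (X : σ.Var) (x : σ.Ran X) : Fml σ b
  | dep (Xs : List σ.Var) (Y : σ.Var) : Fml σ true
  | neg {b : Bool} (α : Fml σ false) : Fml σ b
  | and {b : Bool} (φ ψ : Fml σ b) : Fml σ b
  | or {b : Bool} (φ ψ : Fml σ b) : Fml σ b
  | cf {b : Bool} (M : Multiset (Eqn σ)) (hM : M ≠ 0) (φ : Fml σ b) : Fml σ b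

abbrev CO (σ : Signature.{u, v}) := Fml σ false
abbrev COD (σ : Signature.{u, v}) := Fml σ true

namespace Fml

/-- The inclusion of `CO[σ]` in `COD[σ]`. -/
def lift {b : Bool} : Fml σ b → COD σ
  | atom X x => atom X x
  | dep Xs Y => dep Xs Y
  | neg α => neg α
  | and φ ψ => and φ.lift ψ.lift
  | or φ ψ => or φ.lift ψ.lift
  | cf M hM φ => cf M hM φ.lift

/-- The constancy atom `=(X)`. -/
def con (X : σ.Var) : COD σ := dep [] X

/-- `⊥`, i.e. `X = x ∧ X ≠ x` for a fixed equality `X = x`. -/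
noncomputable def bot {b : Bool} : Fml σ b :=
  let X : σ.Var := Classical.arbitrary σ.Var
  let x : σ.Ran X := Classical.arbitrary (σ.Ran X)
  and (atom X x) (neg (atom X x))

/-- `⊤`, the empty conjunction. -/
noncomputable def top {b : Bool} : Fml σ b := neg bot

open Classical in
/-- `M □→ φ` for a possibly empty antecedent `M`; with the empty antecedent it is `φ` itself. -/
noncomputable def box {b : Bool} (M : Multiset (Eqn σ)) (φ : Fml σ b) : Fml σ b :=
  if h : M = 0 then φ else cf M h φ

/-- The selective implication `α ⊃ φ`. -/
def sel {b : Bool} (α : CO σ) (φ : Fml σ b) : Fml σ b := or (neg α) φ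

noncomputable def orList {b : Bool} : List (Fml σ b) → Fml σ b
  | [] => bot
  | [φ] => φ
  | φ :: ψ :: l => or φ (orList (ψ :: l))

noncomputable def andList {b : Bool} : List (Fml σ b) → Fml σ b
  | [] => top
  | [φ] => φ
  | φ :: ψ :: l => and φ (andList (ψ :: l))

/-- `φ` contains no counterfactual. -/
def BoxFree {b : Bool} : Fml σ b → Prop
  | atom _ _ => True
  | dep _ _ => True
  | neg α => α.BoxFree
  | and φ ψ => φ.BoxFree ∧ ψ.BoxFree
  | or φ ψ => φ.BoxFree ∧ ψ.BoxFree
  | cf _ _ _ => False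

end Fml

/-- A list of all the elements of a finite type, without repetition. -/
noncomputable def enum (ι : Type*) [Finite ι] : List ι :=
  (@Finset.univ ι (Fintype.ofFinite ι)).toList

/-- The disjunction of a finite family of formulas. -/
noncomputable def bigOr {ι : Type*} [Finite ι] {b : Bool} (f : ι → Fml σ b) : Fml σ b :=
  Fml.orList ((enum ι).map f)

/-- The conjunction of a finite family of formulas. -/
noncomputable def bigAnd {ι : Type*} [Finite ι] {b : Bool} (f : ι → Fml σ b) : Fml σ b :=
  Fml.andList ((enum ι).map f)

/-- A tuple of values for a set `W` of variables. -/
abbrev Tuple (W : Set σ.Var) := (X : W) → σ.Ran X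

/-- The equation `W = w`. -/
noncomputable def eqns (W : Set σ.Var) (w : Tuple W) : Multiset (Eqn σ) :=
  ((enum W).map fun X => (⟨X.1, w X⟩ : Eqn σ))

def Consistent (M : Multiset (Eqn σ)) : Prop :=
  ∀ (X : σ.Var) (x x' : σ.Ran X), (⟨X, x⟩ : Eqn σ) ∈ M → (⟨X, x'⟩ : Eqn σ) ∈ M → x = x'

open Classical in
/-- The conjuncts of `M` whose variables do not occur in `N`. -/
noncomputable def removeVars (M N : Multiset (Eqn σ)) : Multiset (Eqn σ) :=
  M.filter fun p => ∀ q ∈ N, q.1 ≠ p.1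

/-! ### Systems of functions and interventions -/

abbrev Assign (σ : Signature.{u, v}) := (X : σ.Var) → σ.Ran X

/-- A law for the variable `V`: a set of parents not containing `V`, and a function
from the values of the parents to the values of `V`. -/
abbrev Law (V : σ.Var) := Σ P : {P : Set σ.Var // V ∉ P}, (Tuple P.1 → σ.Ran V)

/-- A system of functions: every endogenous variable has a law, the others (value `none`)
are exogenous. -/
abbrev Sys (σ : Signature.{u, v}) := (V : σ.Var) → Option (Law V)

namespace Sys

/-- The edges of the graph of `F`: `X` is a parent of `Y`. -/
def Edge (F : Sys σ) (X Y : σ.Var) : Prop := ∃ m : Law Y, F Y = some m ∧ X ∈ m.1.1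

/-- `F` is recursive: its graph has no directed cycle. -/
def Recursive (F : Sys σ) : Prop := ∀ X, ¬ Relation.TransGen F.Edge X X

def Compatible (F : Sys σ) (s : Assign σ) : Prop :=
  ∀ (V : σ.Var) (m : Law V), F V = some m → s V = m.2 (fun X => s X)

theorem Recursive.wf {F : Sys σ} (hF : F.Recursive) : WellFounded F.Edge := by
  have : Std.Irrefl (Relation.TransGen F.Edge) := ⟨hF⟩
  have h : WellFounded (Relation.TransGen F.Edge) :=
    Finite.wellFounded_of_trans_of_irrefl _
  exact Subrelation.wf (fun {_ _} h => Relation.TransGen.single h) h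

open Classical in
/-- The restriction of `F` to the endogenous variables that do not occur in `M`. -/
noncomputable def restrict (F : Sys σ) (M : Multiset (Eqn σ)) : Sys σ :=
  fun V => if ∃ x : σ.Ran V, (⟨V, x⟩ : Eqn σ) ∈ M then none else F V

theorem Recursive.restrict {F : Sys σ} (hF : F.Recursive) (M : Multiset (Eqn σ)) :
    (F.restrict M).Recursive := by
  intro X h
  refine hF X (Relation.TransGen.mono ?_ X X h)
  rintro A B ⟨m, hm, hA⟩
  refine ⟨m, ?_, hA⟩
  unfold Sys.restrict at hm
  split_ifs at hm
  exact hm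

open Classical in
/-- The assignment that results from `s` by the intervention `do(M)`, by recursion along
the graph of `F`. -/
noncomputable def doAssign (F : Sys σ) (hF : F.Recursive) (M : Multiset (Eqn σ))
    (s : Assign σ) : Assign σ :=
  hF.wf.fix fun V ih =>
    if h : ∃ x : σ.Ran V, (⟨V, x⟩ : Eqn σ) ∈ M then h.choose
    else
      match hV : F V with
      | none => s V
      | some m => m.2 (fun X => ih X.1 ⟨m, hV, X.2⟩)

theorem doAssign_of_mem {F : Sys σ} (hF : F.Recursive) {M : Multiset (Eqn σ)}
    (hM : Consistent M) (s : Assign σ) {V : σ.Var} {x : σ.Ran V}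
    (h : (⟨V, x⟩ : Eqn σ) ∈ M) : F.doAssign hF M s V = x := by
  have h' : ∃ x : σ.Ran V, (⟨V, x⟩ : Eqn σ) ∈ M := ⟨x, h⟩
  unfold doAssign
  rw [WellFounded.fix_eq, dif_pos h']
  exact hM V _ _ h'.choose_spec h

theorem doAssign_of_none {F : Sys σ} (hF : F.Recursive) {M : Multiset (Eqn σ)}
    (s : Assign σ) {V : σ.Var} (h : ¬ ∃ x : σ.Ran V, (⟨V, x⟩ : Eqn σ) ∈ M)
    (hV : F V = none) : F.doAssign hF M s V = s V := by
  unfold doAssign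
  rw [WellFounded.fix_eq, dif_neg h]
  split
  · rfl
  · rename_i m hm
    rw [hV] at hm
    cases hm

theorem doAssign_of_some {F : Sys σ} (hF : F.Recursive) {M : Multiset (Eqn σ)}
    (s : Assign σ) {V : σ.Var} (h : ¬ ∃ x : σ.Ran V, (⟨V, x⟩ : Eqn σ) ∈ M)
    {m : Law V} (hV : F V = some m) :
    F.doAssign hF M s V = m.2 (fun X => F.doAssign hF M s X) := by
  conv_lhs => unfold doAssign
  rw [WellFounded.fix_eq, dif_neg h]
  split
  · rename_i hm
    rw [hV] at hm
    cases hm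
  · rename_i m' hm
    rw [hV] at hm
    cases hm
    rfl

theorem compatible_doAssign {F : Sys σ} (hF : F.Recursive) (M : Multiset (Eqn σ))
    (s : Assign σ) : (F.restrict M).Compatible (F.doAssign hF M s) := by
  intro V m hm
  unfold Sys.restrict at hm
  split_ifs at hm with h
  exact doAssign_of_some hF s h hm

/-- `V` is endogenous and its law is not a constant function. -/
def NonConst (F : Sys σ) (V : σ.Var) : Prop :=
  ∃ m : Law V, F V = some m ∧ ¬ ∃ c, ∀ p, m.2 p = c

/-- Equivalence up to dummy arguments. -/
def Sim (F G : Sys σ) : Prop :=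
  (∀ V, F.NonConst V ↔ G.NonConst V) ∧
  ∀ (V : σ.Var) (m n : Law V), F.NonConst V → F V = some m → G V = some n →
    ∀ (p : Tuple m.1.1) (q : Tuple n.1.1),
      (∀ (X : σ.Var) (h : X ∈ m.1.1) (h' : X ∈ n.1.1), p ⟨X, h⟩ = q ⟨X, h'⟩) → m.2 p = n.2 q

end Sys

/-! ### Team semantics -/

/-- A (recursive) causal team. -/
structure CausalTeam (σ : Signature.{u, v}) where
  team : Set (Assign σ)
  fn : Sys σ
  recursive : fn.Recursive
  compat : ∀ s ∈ team, fn.Compatible s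

namespace CausalTeam

/-- Causal subteams. -/
def Sub (S T : CausalTeam σ) : Prop := S.team ⊆ T.team ∧ S.fn = T.fn

/-- The subteam with the single assignment `s`. -/
def single (T : CausalTeam σ) (s : Assign σ) (hs : s ∈ T.team) : CausalTeam σ where
  team := {s}
  fn := T.fn
  recursive := T.recursive
  compat := by
    rintro t rfl
    exact T.compat t hs

/-- The causal team produced by `do(M)`. -/
noncomputable def intervene (T : CausalTeam σ) (M : Multiset (Eqn σ)) : CausalTeam σ where
  team := T.fn.doAssign T.recursive M '' T.team
  fn := T.fn.restrict M
  recursive := T.recursive.restrict M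
  compat := by
    rintro _ ⟨s, _, rfl⟩
    exact Sys.compatible_doAssign T.recursive M s

/-- Satisfaction over causal teams. -/
def Sat {b : Bool} : CausalTeam σ → Fml σ b → Prop
  | T, .atom X x => ∀ s ∈ T.team, s X = x
  | T, .dep Xs Y => ∀ s ∈ T.team, ∀ s' ∈ T.team, (∀ X ∈ Xs, s X = s' X) → s Y = s' Y
  | T, .neg α => ∀ s, ∀ hs : s ∈ T.team, ¬ Sat (T.single s hs) α
  | T, .and φ ψ => Sat T φ ∧ Sat T ψ
  | T, .or φ ψ => ∃ T₁ T₂ : CausalTeam σ, T₁.Sub T ∧ T₂.Sub T ∧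
      T₁.team ∪ T₂.team = T.team ∧ Sat T₁ φ ∧ Sat T₂ ψ
  | T, .cf M _ φ => ¬ Consistent M ∨ Sat (T.intervene M) φ

end CausalTeam

/-- The pairs of a recursive system of functions and an assignment compatible with it
(deterministic causal models). -/
abbrev Sem (σ : Signature.{u, v}) :=
  {p : Assign σ × Sys σ // p.2.Recursive ∧ p.2.Compatible p.1}

namespace Sem

noncomputable def intervene (M : Multiset (Eqn σ)) (a : Sem σ) : Sem σ :=
  ⟨(a.1.2.doAssign a.2.1 M a.1.1, a.1.2.restrict M),
    a.2.1.restrict M, Sys.compatible_doAssign a.2.1 M a.1.1⟩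

/-- Same assignment, and systems of functions that are equivalent up to dummy arguments. -/
def Equiv (a b : Sem σ) : Prop := a.1.1 = b.1.1 ∧ a.1.2.Sim b.1.2

end Sem

/-- A (recursive) generalized causal team. -/
abbrev GTeam (σ : Signature.{u, v}) := Set (Sem σ)

/-- Satisfaction over generalized causal teams. -/
def GSat {b : Bool} : GTeam σ → Fml σ b → Prop
  | T, .atom X x => ∀ a ∈ T, a.1.1 X = x
  | T, .dep Xs Y => ∀ a ∈ T, ∀ a' ∈ T, (∀ X ∈ Xs, a.1.1 X = a'.1.1 X) → a.1.1 Y = a'.1.1 Y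
  | T, .neg α => ∀ a ∈ T, ¬ GSat {a} α
  | T, .and φ ψ => GSat T φ ∧ GSat T ψ
  | T, .or φ ψ => ∃ T₁ T₂ : GTeam σ, T₁ ⊆ T ∧ T₂ ⊆ T ∧ T₁ ∪ T₂ = T ∧ GSat T₁ φ ∧ GSat T₂ ψ
  | T, .cf M _ φ => ¬ Consistent M ∨ GSat (Sem.intervene M '' T) φ

/-- Semantic consequence over causal teams. -/
def CEntails (Γ : Set (COD σ)) (ψ : COD σ) : Prop :=
  ∀ T : CausalTeam σ, (∀ φ ∈ Γ, T.Sat φ) → T.Sat ψ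

/-- Semantic consequence over generalized causal teams. -/
def GEntails (Γ : Set (COD σ)) (ψ : COD σ) : Prop :=
  ∀ T : GTeam σ, (∀ φ ∈ Γ, GSat T φ) → GSat T ψ

/-! ### Formulas used in the rules and axioms -/

open Fml

/-- The formula `X ⇝ Y` (`X` causally affects `Y`). -/
noncomputable def affects (X Y : σ.Var) : CO σ :=
  bigOr (ι := {q : (Σ Z : Set σ.Var, Tuple Z) × (σ.Ran X × σ.Ran X) × (σ.Ran Y × σ.Ran Y) //
      (X ∉ q.1.1 ∧ Y ∉ q.1.1) ∧ q.2.1.1 ≠ q.2.1.2 ∧ q.2.2.1 ≠ q.2.2.2})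
    fun q => box (eqns q.1.1.1 q.1.1.2)
      (and (box {⟨X, q.1.2.1.1⟩} (atom Y q.1.2.2.1)) (box {⟨X, q.1.2.1.2⟩} (atom Y q.1.2.2.2)))

/-- The variables other than `V`. -/
abbrev others (V : σ.Var) : Set σ.Var := {X | X ≠ V}

/-- The formula saying that `X` is a direct cause of `V`. -/
noncomputable def betaDC (X V : σ.Var) : CO σ :=
  bigOr (ι := {q : Tuple ({X, V}ᶜ : Set σ.Var) × (σ.Ran X × σ.Ran X) × (σ.Ran V × σ.Ran V) //
      q.2.1.1 ≠ q.2.1.2 ∧ q.2.2.1 ≠ q.2.2.2})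
    fun q => and
      (box (eqns _ q.1.1 + {⟨X, q.1.2.1.1⟩}) (atom V q.1.2.2.1))
      (box (eqns _ q.1.1 + {⟨X, q.1.2.1.2⟩}) (atom V q.1.2.2.2))

/-- The formula saying that `V` has a direct cause. -/
noncomputable def betaEn (V : σ.Var) : CO σ :=
  bigOr fun X : others V => betaDC X.1 V

/-- The conjunction of all `W_V = w □→ =(V)`, where `W_V` consists of the variables other
than `V`. -/
noncomputable def allCon (V : σ.Var) : COD σ :=
  bigAnd fun w : Tuple (others V) => box (eqns _ w) (con V)

/-- The axiom `1Fun`. -/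
noncomputable def oneFun (σ : Signature.{u, v}) : COD σ :=
  bigAnd fun V : σ.Var => sel (betaEn V) (allCon V)

/-- `V` obeys the law `m`. -/
noncomputable def eta (V : σ.Var) (m : Law V) : CO σ :=
  bigAnd fun q : Tuple ((m.1.1 ∪ {V})ᶜ : Set σ.Var) × Tuple m.1.1 =>
    box (eqns _ q.1 + eqns _ q.2) (atom V (m.2 q.2))

/-- `V` is not affected by interventions on the other variables. -/
noncomputable def xi (V : σ.Var) : CO σ :=
  bigAnd fun q : σ.Ran V × Tuple (others V) =>
    sel (atom V q.1) (box (eqns _ q.2) (atom V q.1))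

/-- The formula `Φ^F`: `eta` for every endogenous variable, `xi` for every variable that is
exogenous or has a constant law. -/
noncomputable def Phi (F : Sys σ) : CO σ :=
  and (bigAnd fun q : {q : Σ V : σ.Var, Law V // F q.1 = some q.2} => eta q.1.1 q.1.2)
    (bigAnd fun V : {V : σ.Var // ¬ F.NonConst V} => xi V.1)

/-- `⋀_V V = s(V) ∧ Φ^F`, which describes the causal model `(s, F)` up to equivalence. -/
noncomputable def describe (a : Sem σ) : CO σ :=
  and (bigAnd fun V : σ.Var => atom V (a.1.1 V)) (Phi a.1.2)

/-- The formula `Θ^T` for a generalized causal team `T`. -/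
noncomputable def Theta (T : GTeam σ) : CO σ := bigOr fun a : T => describe a.1

/-- The formula `χ₁`, saying that all the members of the team are equivalent. -/
noncomputable def chiOne (σ : Signature.{u, v}) : COD σ :=
  bigAnd fun V : σ.Var => and (con V) (allCon V)

/-- The formula `Ξ_*^{a,b}` for two inequivalent causal models `a`, `b`: apart from at most one
model (up to equivalence), the members of the team are equivalent to neither `a` nor `b`. -/
noncomputable def XiStar (a b : Sem σ) : COD σ :=
  or (chiOne σ) (Theta {c : Sem σ | ¬ c.Equiv a ∧ ¬ c.Equiv b}).lift

/-- The axiom `NoMix`. -/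
noncomputable def noMix (σ : Signature.{u, v}) : COD σ :=
  bigAnd fun V : σ.Var =>
    bigAnd fun q : {q : Sem σ × Sem σ //
        GSat {q.1} (betaEn V) ∧ ¬ GSat {q.2} (betaEn V)} => XiStar q.1.1 q.1.2

/-- `COD`-formulas with one hole.  The hole is never inside a negation, since dependence atoms
do not occur there. -/
inductive Ctx (σ : Signature.{u, v}) : Type (max u v)
  | hole : Ctx σ
  | andL (C : Ctx σ) (ψ : COD σ) : Ctx σ
  | andR (φ : COD σ) (C : Ctx σ) : Ctx σ
  | orL (C : Ctx σ) (ψ : COD σ) : Ctx σ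
  | orR (φ : COD σ) (C : Ctx σ) : Ctx σ
  | cf (M : Multiset (Eqn σ)) (hM : M ≠ 0) (C : Ctx σ) : Ctx σ

def Ctx.fill (χ : COD σ) : Ctx σ → COD σ
  | .hole => χ
  | .andL C ψ => and (C.fill χ) ψ
  | .andR φ C => and φ (C.fill χ)
  | .orL C ψ => or (C.fill χ) ψ
  | .orR φ C => or φ (C.fill χ)
  | .cf M hM C => Fml.cf M hM (C.fill χ)

/-! ### Natural deduction -/

/-- Natural deduction for `COD[σ]` with additional axioms `Ax`; `α` stands for a `CO`-formula.
In the rule `boxSub` the subderivation of `ψ` uses no open assumption except `φ`. -/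
inductive Derives (Ax : Set (COD σ)) : Set (COD σ) → COD σ → Prop
  | hyp {Γ φ} : φ ∈ Γ → Derives Ax Γ φ
  | ax {Γ φ} : φ ∈ Ax → Derives Ax Γ φ
  -- value ranges
  | valDef {Γ} (X : σ.Var) : Derives Ax Γ (bigOr fun x : σ.Ran X => atom X x)
  | valUnq {Γ} (X : σ.Var) (x x' : σ.Ran X) : x ≠ x' →
      Derives Ax Γ (atom X x) → Derives Ax Γ (neg (atom X x'))
  -- conjunction, disjunction, negation
  | andI {Γ φ ψ} : Derives Ax Γ φ → Derives Ax Γ ψ → Derives Ax Γ (and φ ψ)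
  | andE₁ {Γ φ ψ} : Derives Ax Γ (and φ ψ) → Derives Ax Γ φ
  | andE₂ {Γ φ ψ} : Derives Ax Γ (and φ ψ) → Derives Ax Γ ψ
  | orI₁ {Γ φ ψ} : Derives Ax Γ φ → Derives Ax Γ (or φ ψ)
  | orI₂ {Γ φ ψ} : Derives Ax Γ φ → Derives Ax Γ (or ψ φ)
  | orE {Γ φ ψ} {α : CO σ} : Derives Ax Γ (or φ ψ) → Derives Ax (insert φ Γ) α.lift →
      Derives Ax (insert ψ Γ) α.lift → Derives Ax Γ α.lift
  | negI {Γ} {α : CO σ} : Derives Ax (insert α.lift Γ) bot → Derives Ax Γ (neg α)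
  | negE {Γ φ} {α : CO σ} : Derives Ax Γ α.lift → Derives Ax Γ (neg α) → Derives Ax Γ φ
  | raa {Γ} {α : CO σ} : Derives Ax (insert (neg α) Γ) bot → Derives Ax Γ α.lift
  -- counterfactuals
  | boxEff {Γ} (M : Multiset (Eqn σ)) (Y : σ.Var) (y : σ.Ran Y) :
      Derives Ax Γ (box (M + {⟨Y, y⟩}) (atom Y y))
  | boxCmp {Γ γ M} {W : σ.Var} {w : σ.Ran W} : γ.BoxFree →
      Derives Ax Γ (box M (atom W w)) → Derives Ax Γ (box M γ) →
      Derives Ax Γ (box (M + {⟨W, w⟩}) γ)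
  | boxBotE {Γ φ M} : Consistent M → Derives Ax Γ (box M bot) → Derives Ax Γ φ
  | botBoxE {Γ φ} (M : Multiset (Eqn σ)) (X : σ.Var) (x x' : σ.Ran X) : x ≠ x' →
      Derives Ax Γ (box (M + {⟨X, x⟩} + {⟨X, x'⟩}) φ)
  | boxCtr {Γ φ M} {e : Eqn σ} :
      Derives Ax Γ (box ({e} + {e} + M) φ) → Derives Ax Γ (box ({e} + M) φ)
  | boxWk {Γ φ M} {e : Eqn σ} :
      Derives Ax Γ (box ({e} + M) φ) → Derives Ax Γ (box ({e} + {e} + M) φ)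
  | boxSub {Γ φ ψ M} : Derives Ax Γ (box M φ) → Derives Ax {φ} ψ → Derives Ax Γ (box M ψ)
  | boxAndI {Γ φ ψ M} : Derives Ax Γ (box M φ) → Derives Ax Γ (box M ψ) →
      Derives Ax Γ (box M (and φ ψ))
  | boxOrDst {Γ φ ψ M} : Derives Ax Γ (box M (or φ ψ)) →
      Derives Ax Γ (or (box M φ) (box M ψ))
  | boxOrDstInv {Γ φ ψ M} : Derives Ax Γ (or (box M φ) (box M ψ)) →
      Derives Ax Γ (box M (or φ ψ))
  | boxExtr {Γ φ M N} : Consistent M → Derives Ax Γ (box M (box N φ)) →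
      Derives Ax Γ (box (removeVars M N + N) φ)
  | boxExp {Γ φ} {M N : Multiset (Eqn σ)} : (∀ p ∈ M, ∀ q ∈ N, p.1 ≠ q.1) →
      Derives Ax Γ (box (M + N) φ) → Derives Ax Γ (box M (box N φ))
  | negBoxE {Γ M} {α : CO σ} : Derives Ax Γ (neg (box M α)) → Derives Ax Γ (box M (neg α))
  | recur {Γ} {k : ℕ} (X : Fin (k + 2) → σ.Var) : Function.Injective X →
      (∀ i : Fin (k + 1), Derives Ax Γ (affects (X i.castSucc) (X i.succ)).lift) →
      Derives Ax Γ (neg (affects (X (Fin.last (k + 1))) (X 0)))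
  -- additional rules for disjunction
  | orCom {Γ φ ψ} : Derives Ax Γ (or φ ψ) → Derives Ax Γ (or ψ φ)
  | orAss {Γ φ ψ χ} : Derives Ax Γ (or (or φ ψ) χ) → Derives Ax Γ (or φ (or ψ χ))
  | orSub {Γ φ ψ χ} : Derives Ax Γ (or φ ψ) → Derives Ax (insert φ Γ) χ →
      Derives Ax Γ (or χ ψ)
  -- dependence atoms
  | depI₀ {Γ} {X : σ.Var} {x : σ.Ran X} : Derives Ax Γ (atom X x) → Derives Ax Γ (con X)
  | depI {Γ} {Xs : List σ.Var} {Y : σ.Var} :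
      Derives Ax (Γ ∪ {χ | ∃ X ∈ Xs, χ = con X}) (con Y) → Derives Ax Γ (dep Xs Y)
  | dep₀E {Γ ψ} {X : σ.Var} (C : Ctx σ) : Derives Ax Γ (C.fill (con X)) →
      (∀ x : σ.Ran X, Derives Ax (insert (C.fill (atom X x)) Γ) ψ) → Derives Ax Γ ψ
  | depE {Γ} {Xs : List σ.Var} {Y : σ.Var} : Derives Ax Γ (dep Xs Y) →
      (∀ X ∈ Xs, Derives Ax Γ (con X)) → Derives Ax Γ (con Y)

/-- Derivability in the system for generalized causal teams. -/
def GDerives (Γ : Set (COD σ)) (ψ : COD σ) : Prop := Derives ∅ Γ ψ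

/-- Derivability in the system for causal teams, which has the axioms `1Fun` and `NoMix`. -/
def CDerives (Γ : Set (COD σ)) (ψ : COD σ) : Prop := Derives {oneFun σ, noMix σ} Γ ψ

end CTeam

namespace CTeam

variable {σ : Signature.{u, v}}

open Fml

/-! Soundness is an induction on derivations over a class of generalized causal teams closed under
subteams and interventions: all teams for the first system, the uniform ones (a single system of
functions) for the second (`Derives.sound`).

Completeness starts with `CO`. These formulas are flat: a team satisfies one iff each of its models
does. There are only finitely many interventions up to order and repetition of equations, so a
consistent set can be enlarged until it decides the outcome of each (`exists_deciding`). The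
outcomes form a family of assignments obeying effectiveness and composition, and `recur` forbids
cyclic dependence, so the family is that of a recursive causal model
(`EffectiveFamily.exists_model`). A truth lemma (`Derives.truth`) then gives strong completeness for
`CO` (`derives_of_gsat`).

A `COD`-formula is reduced to `CO` by its realizations (`Realizes`): `CO`-formulas that imply it,
that may replace it in a proof by cases, and one of which holds in each team satisfying it. The case
split comes from `dep₀E`; a dependence atom is first unfolded into a disjunction over the values of
its determining variables. If `α` realizes the premises, the largest team satisfying `α` satisfies
them, hence satisfies `ψ`, hence some realization `β` of `ψ`; `α` proves `β` by completeness for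
`CO`, and `β` proves `ψ`.

For causal teams, both axioms hold in uniform teams. Conversely a generalized team satisfying them
has the same theory as a uniform one (`exists_uniform`), and nonempty uniform teams are causal
teams. So completeness over causal teams is completeness over generalized teams with the two axioms
as extra premises. -/

theorem mem_enum {ι : Type*} [Finite ι] (i : ι) : i ∈ enum ι := by
  simp [enum]

/-! ### Equations as multisets. -/

theorem mem_eqns {W : Set σ.Var} {w : Tuple W} {p : Eqn σ} :
    p ∈ eqns W w ↔ ∃ h : p.1 ∈ W, w ⟨p.1, h⟩ = p.2 := by
  simp only [eqns, Multiset.mem_coe, List.mem_map]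
  constructor
  · rintro ⟨X, -, rfl⟩
    exact ⟨X.2, rfl⟩
  · rintro ⟨h, hp⟩
    exact ⟨⟨p.1, h⟩, mem_enum _, by rw [hp]⟩

theorem consistent_zero : Consistent (0 : Multiset (Eqn σ)) := by
  intro X x x' h
  simp at h

theorem Consistent.mono {M N : Multiset (Eqn σ)} (hN : Consistent N) (h : ∀ p ∈ M, p ∈ N) :
    Consistent M := fun X x x' hx hx' => hN X x x' (h _ hx) (h _ hx')

theorem consistent_of_assign {M : Multiset (Eqn σ)} (t : Assign σ) (h : ∀ p ∈ M, t p.1 = p.2) :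
    Consistent M := fun X x x' hx hx' => (h ⟨X, x⟩ hx).symm.trans (h ⟨X, x'⟩ hx')

theorem consistent_eqns (W : Set σ.Var) (w : Tuple W) : Consistent (eqns W w) := by
  intro X x x' hx hx'
  obtain ⟨h, e⟩ := mem_eqns.1 hx
  obtain ⟨h', e'⟩ := mem_eqns.1 hx'
  exact e.symm.trans e'

theorem mem_removeVars_add {M N : Multiset (Eqn σ)} {p : Eqn σ} :
    p ∈ removeVars M N + N ↔ (p ∈ M ∧ ∀ q ∈ N, q.1 ≠ p.1) ∨ p ∈ N := by
  classical
  simp [removeVars, Multiset.mem_add]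

theorem consistent_removeVars_add {M N : Multiset (Eqn σ)} (hM : Consistent M)
    (hN : Consistent N) : Consistent (removeVars M N + N) := by
  intro X x x' hx hx'
  rw [mem_removeVars_add] at hx hx'
  rcases hx with ⟨hx, h⟩ | hx <;> rcases hx' with ⟨hx', h'⟩ | hx'
  · exact hM X x x' hx hx'
  · exact absurd rfl (h ⟨X, x'⟩ hx')
  · exact absurd rfl (h' ⟨X, x⟩ hx)
  · exact hN X x x' hx hx'

open Classical in
theorem mem_eqns_update {X V : σ.Var} (hXV : X ≠ V) (w : Assign σ) (x : σ.Ran X) (p : Eqn σ) :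
    p ∈ eqns (others V) (fun Y => Function.update w X x Y) ↔
      p ∈ eqns ({X, V}ᶜ : Set σ.Var) (fun Y => w Y) + {⟨X, x⟩} := by
  rcases p with ⟨Y, y⟩
  rw [Multiset.mem_add, Multiset.mem_singleton, mem_eqns, mem_eqns]
  constructor
  · rintro ⟨hY, e⟩
    by_cases hYX : Y = X
    · subst hYX
      have : y = x := by simpa using e.symm
      exact .inr (by rw [this])
    · left
      refine ⟨fun h => h.elim hYX hY, ?_⟩
      rw [← e]
      simp [hYX]
  · rintro (⟨hY, e⟩ | e)
    · have hYX : Y ≠ X := fun h => hY (.inl h)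
      refine ⟨fun h => hY (.inr h), ?_⟩
      rw [← e]
      simp [hYX]
    · cases e
      exact ⟨hXV, by simp⟩

/-! ### Interventions -/

theorem Sys.restrict_of_mem (F : Sys σ) {M : Multiset (Eqn σ)} {V : σ.Var}
    (h : ∃ x : σ.Ran V, (⟨V, x⟩ : Eqn σ) ∈ M) : F.restrict M V = none := if_pos h

theorem Sys.restrict_of_notMem (F : Sys σ) {M : Multiset (Eqn σ)} {V : σ.Var}
    (h : ¬ ∃ x : σ.Ran V, (⟨V, x⟩ : Eqn σ) ∈ M) : F.restrict M V = F V := if_neg h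

/-- Along a well-founded graph the three clauses have only one solution. Identities between
interventions are proved by checking these clauses for the other side. -/
theorem Sys.doAssign_unique {F : Sys σ} (hF : F.Recursive) {M : Multiset (Eqn σ)}
    (hM : Consistent M) {s t : Assign σ}
    (h₁ : ∀ V x, (⟨V, x⟩ : Eqn σ) ∈ M → t V = x)
    (h₂ : ∀ V, (¬ ∃ x : σ.Ran V, (⟨V, x⟩ : Eqn σ) ∈ M) → F V = none → t V = s V)
    (h₃ : ∀ V m, (¬ ∃ x : σ.Ran V, (⟨V, x⟩ : Eqn σ) ∈ M) → F V = some m →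
      t V = m.2 (fun X => t X)) :
    F.doAssign hF M s = t := by
  funext V
  induction V using hF.wf.induction with
  | _ V ih =>
    by_cases hV : ∃ x : σ.Ran V, (⟨V, x⟩ : Eqn σ) ∈ M
    · obtain ⟨x, hx⟩ := hV
      rw [doAssign_of_mem hF hM s hx, h₁ V x hx]
    · rcases hm : F V with _ | m
      · rw [doAssign_of_none hF s hV hm, h₂ V hV hm]
      · rw [doAssign_of_some hF s hV hm, h₃ V m hV hm]
        exact congrArg m.2 (funext fun X => ih X ⟨m, hm, X.2⟩)

namespace Sem

/-- The assignment that results from the intervention `do(M)` on `a`. -/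
noncomputable abbrev val (a : Sem σ) (M : Multiset (Eqn σ)) : Assign σ := (a.intervene M).1.1

theorem val_mem (a : Sem σ) {M : Multiset (Eqn σ)} (hM : Consistent M) {V : σ.Var} {x : σ.Ran V}
    (h : (⟨V, x⟩ : Eqn σ) ∈ M) : a.val M V = x := Sys.doAssign_of_mem a.2.1 hM _ h

theorem val_none (a : Sem σ) {M : Multiset (Eqn σ)} {V : σ.Var}
    (h : ¬ ∃ x : σ.Ran V, (⟨V, x⟩ : Eqn σ) ∈ M) (hV : a.1.2 V = none) : a.val M V = a.1.1 V :=
  Sys.doAssign_of_none a.2.1 _ h hV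

theorem val_some (a : Sem σ) {M : Multiset (Eqn σ)} {V : σ.Var}
    (h : ¬ ∃ x : σ.Ran V, (⟨V, x⟩ : Eqn σ) ∈ M) {m : Law V} (hV : a.1.2 V = some m) :
    a.val M V = m.2 (fun X => a.val M X) :=
  Sys.doAssign_of_some a.2.1 _ h hV

theorem intervene_congr (a : Sem σ) {M N : Multiset (Eqn σ)} (hM : Consistent M)
    (h : ∀ p, p ∈ M ↔ p ∈ N) : a.intervene M = a.intervene N := by
  have hN : Consistent N := hM.mono fun p hp => (h p).2 hp
  refine Subtype.ext (Prod.ext ?_ ?_)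
  · refine Sys.doAssign_unique a.2.1 hM ?_ ?_ ?_
    · exact fun V x hx => a.val_mem hN ((h _).1 hx)
    · intro V hV hn
      exact a.val_none (by simpa only [h] using hV) hn
    · intro V m hV hm
      exact a.val_some (by simpa only [h] using hV) hm
  · funext V
    change a.1.2.restrict M V = a.1.2.restrict N V
    by_cases hV : ∃ x : σ.Ran V, (⟨V, x⟩ : Eqn σ) ∈ N
    · rw [Sys.restrict_of_mem _ hV, Sys.restrict_of_mem _ (by simpa only [h] using hV)]
    · rw [Sys.restrict_of_notMem _ hV, Sys.restrict_of_notMem _ (by simpa only [h] using hV)]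

theorem intervene_zero (a : Sem σ) : a.intervene 0 = a := by
  refine Subtype.ext (Prod.ext ?_ ?_)
  · refine Sys.doAssign_unique a.2.1 consistent_zero ?_ ?_ ?_
    · intro V x hx
      simp at hx
    · exact fun V _ _ => rfl
    · exact fun V m _ hm => a.2.2 V m hm
  · funext V
    simp [intervene, Sys.restrict]

theorem intervene_intervene (a : Sem σ) {M N : Multiset (Eqn σ)} (hM : Consistent M)
    (hN : Consistent N) :
    (a.intervene M).intervene N = a.intervene (removeVars M N + N) := by
  have hK := consistent_removeVars_add hM hN
  have key : ∀ V : σ.Var, (∃ x : σ.Ran V, (⟨V, x⟩ : Eqn σ) ∈ removeVars M N + N) ↔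
      (∃ x : σ.Ran V, (⟨V, x⟩ : Eqn σ) ∈ M) ∨ (∃ x : σ.Ran V, (⟨V, x⟩ : Eqn σ) ∈ N) := by
    intro V
    constructor
    · rintro ⟨x, hx⟩
      rw [mem_removeVars_add] at hx
      rcases hx with ⟨hx, -⟩ | hx
      · exact .inl ⟨x, hx⟩
      · exact .inr ⟨x, hx⟩
    · intro h
      by_cases hV : ∃ x : σ.Ran V, (⟨V, x⟩ : Eqn σ) ∈ N
      · obtain ⟨x, hx⟩ := hV
        exact ⟨x, mem_removeVars_add.2 (.inr hx)⟩
      · obtain ⟨x, hx⟩ := h.resolve_right hV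
        refine ⟨x, mem_removeVars_add.2 (.inl ⟨hx, ?_⟩)⟩
        rintro ⟨Y, y⟩ hy (rfl : Y = V)
        exact hV ⟨y, hy⟩
  -- The combined intervention has to stand on the left, so that uniqueness can be applied with the
  -- two-step assignment as candidate.
  symm
  refine Subtype.ext (Prod.ext ?_ ?_)
  · refine Sys.doAssign_unique a.2.1 hK ?_ ?_ ?_
    · intro V x hx
      rw [mem_removeVars_add] at hx
      rcases hx with ⟨hx, h⟩ | hx
      · have hV : ¬ ∃ y : σ.Ran V, (⟨V, y⟩ : Eqn σ) ∈ N := fun ⟨y, hy⟩ => h _ hy rfl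
        refine ((a.intervene M).val_none hV ?_).trans (a.val_mem hM hx)
        exact Sys.restrict_of_mem _ ⟨x, hx⟩
      · exact (a.intervene M).val_mem hN hx
    · intro V hV hn
      rw [key, not_or] at hV
      refine ((a.intervene M).val_none hV.2 ?_).trans (a.val_none hV.1 hn)
      exact (Sys.restrict_of_notMem _ hV.1).trans hn
    · intro V m hV hm
      rw [key, not_or] at hV
      refine (a.intervene M).val_some hV.2 ?_
      exact (Sys.restrict_of_notMem _ hV.1).trans hm
  · funext V
    change a.1.2.restrict _ V = (a.1.2.restrict M).restrict N V
    by_cases h₂ : ∃ x : σ.Ran V, (⟨V, x⟩ : Eqn σ) ∈ N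
    · rw [Sys.restrict_of_mem _ h₂, Sys.restrict_of_mem _ ((key V).2 (.inr h₂))]
    rw [Sys.restrict_of_notMem _ h₂]
    by_cases h₁ : ∃ x : σ.Ran V, (⟨V, x⟩ : Eqn σ) ∈ M
    · rw [Sys.restrict_of_mem _ h₁, Sys.restrict_of_mem _ ((key V).2 (.inl h₁))]
    · rw [Sys.restrict_of_notMem _ h₁,
        Sys.restrict_of_notMem _ fun h => ((key V).1 h).elim h₁ h₂]

theorem intervene_add (a : Sem σ) {M N : Multiset (Eqn σ)} (hM : Consistent M)
    (hN : Consistent N) (h : ∀ p ∈ M, ∀ q ∈ N, p.1 ≠ q.1) :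
    (a.intervene M).intervene N = a.intervene (M + N) := by
  rw [intervene_intervene a hM hN]
  refine a.intervene_congr (consistent_removeVars_add hM hN) fun p => ?_
  rw [mem_removeVars_add, Multiset.mem_add]
  exact or_congr_left ⟨fun h => h.1, fun hp => ⟨hp, fun q hq e => h p hp q hq e.symm⟩⟩

end Sem

/-! ### Basic properties of satisfaction -/

theorem gsat_mono {b : Bool} {φ : Fml σ b} {S T : GTeam σ} (h : S ⊆ T) (hT : GSat T φ) :
    GSat S φ := by
  induction φ generalizing S T with
  | atom X x => exact fun a ha => hT a (h ha)
  | dep Xs Y => exact fun a ha a' ha' => hT a (h ha) a' (h ha')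
  | neg α => exact fun a ha => hT a (h ha)
  | and φ ψ ih₁ ih₂ => exact ⟨ih₁ h hT.1, ih₂ h hT.2⟩
  | or φ ψ ih₁ ih₂ =>
    obtain ⟨T₁, T₂, -, -, e, h₁, h₂⟩ := hT
    refine ⟨T₁ ∩ S, T₂ ∩ S, Set.inter_subset_right, Set.inter_subset_right, ?_,
      ih₁ Set.inter_subset_left h₁, ih₂ Set.inter_subset_left h₂⟩
    rw [← Set.union_inter_distrib_right, e]
    exact Set.inter_eq_right.2 h
  | cf M hM φ ih => exact hT.imp_right fun hT => ih (Set.image_mono h) hT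

theorem gsat_empty {b : Bool} (φ : Fml σ b) : GSat ∅ φ := by
  induction φ with
  | atom X x => exact fun a ha => ha.elim
  | dep Xs Y => exact fun a ha => ha.elim
  | neg α => exact fun a ha => ha.elim
  | and φ ψ ih₁ ih₂ => exact ⟨ih₁, ih₂⟩
  | or φ ψ ih₁ ih₂ => exact ⟨∅, ∅, subset_rfl, subset_rfl, Set.union_self _, ih₁, ih₂⟩
  | cf M hM φ ih => exact .inr (by rwa [Set.image_empty])

theorem gsat_lift {b : Bool} {φ : Fml σ b} {T : GTeam σ} : GSat T φ.lift ↔ GSat T φ := by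
  induction φ generalizing T with
  | atom X x => rfl
  | dep Xs Y => rfl
  | neg α => rfl
  | and φ ψ ih₁ ih₂ => exact and_congr ih₁ ih₂
  | or φ ψ ih₁ ih₂ => simp only [lift, GSat, ih₁, ih₂]
  | cf M hM φ ih => exact or_congr_right ih

/-- Without dependence atoms nothing compares two models. For a disjunction the team is split
according to which disjunct each model satisfies. -/
theorem gsat_flat (α : CO σ) {T : GTeam σ} : GSat T α ↔ ∀ a ∈ T, GSat {a} α := by
  refine ⟨fun h a ha => gsat_mono (Set.singleton_subset_iff.2 ha) h, ?_⟩
  suffices H : ∀ b (φ : Fml σ b), b = false → ∀ T : GTeam σ, (∀ a ∈ T, GSat {a} φ) → GSat T φ from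
    H _ α rfl T
  clear α T
  intro b φ hb
  induction φ with
  | atom X x => exact fun T h a ha => h a ha a rfl
  | dep Xs Y => cases hb
  | neg α => exact fun T h a ha => h a ha a rfl
  | and φ ψ ih₁ ih₂ => exact fun T h => ⟨ih₁ hb T fun a ha => (h a ha).1, ih₂ hb T fun a ha => (h a ha).2⟩
  | or φ ψ ih₁ ih₂ =>
    intro T h
    refine ⟨{a ∈ T | GSat {a} φ}, {a ∈ T | GSat {a} ψ}, Set.sep_subset _ _, Set.sep_subset _ _, ?_,
      ih₁ hb _ fun a ha => ha.2, ih₂ hb _ fun a ha => ha.2⟩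
    refine Set.Subset.antisymm (Set.union_subset (Set.sep_subset _ _) (Set.sep_subset _ _)) ?_
    intro a ha
    obtain ⟨T₁, T₂, -, -, e, h₁, h₂⟩ := h a ha
    have : a ∈ T₁ ∪ T₂ := e ▸ rfl
    rcases this with h | h
    · exact .inl ⟨ha, gsat_mono (Set.singleton_subset_iff.2 h) h₁⟩
    · exact .inr ⟨ha, gsat_mono (Set.singleton_subset_iff.2 h) h₂⟩
  | cf M hM φ ih =>
    intro T h
    by_cases hc : Consistent M
    · refine .inr (ih hb _ ?_)
      rintro _ ⟨a, ha, rfl⟩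
      have := (h a ha).resolve_left (not_not_intro hc)
      rwa [Set.image_singleton] at this
    · exact .inl hc

theorem gsat_bot {b : Bool} {T : GTeam σ} : GSat T (bot : Fml σ b) ↔ T = ∅ := by
  constructor
  · rintro ⟨h, h'⟩
    refine Set.eq_empty_of_forall_notMem fun a ha => h' a ha ?_
    rintro _ rfl
    exact h _ ha
  · rintro rfl
    exact gsat_empty _

theorem gsat_top {b : Bool} {T : GTeam σ} : GSat T (top : Fml σ b) := by
  intro a _ h
  exact Set.singleton_ne_empty a (gsat_bot.1 h)

theorem gsat_or_left {b : Bool} {φ ψ : Fml σ b} {T : GTeam σ} (h : GSat T φ) :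
    GSat T (or φ ψ) :=
  ⟨T, ∅, subset_rfl, Set.empty_subset _, Set.union_empty _, h, gsat_empty _⟩

theorem gsat_or_right {b : Bool} {φ ψ : Fml σ b} {T : GTeam σ} (h : GSat T ψ) :
    GSat T (or φ ψ) :=
  ⟨∅, T, Set.empty_subset _, subset_rfl, Set.empty_union _, gsat_empty _, h⟩

/-- By downward closure a cover can always be cut down to `T`. -/
theorem gsat_or_iff {b : Bool} {φ ψ : Fml σ b} {T : GTeam σ} :
    GSat T (or φ ψ) ↔ ∃ T₁ T₂ : GTeam σ, T ⊆ T₁ ∪ T₂ ∧ GSat T₁ φ ∧ GSat T₂ ψ := by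
  constructor
  · rintro ⟨T₁, T₂, -, -, e, h₁, h₂⟩
    exact ⟨T₁, T₂, e.ge, h₁, h₂⟩
  · rintro ⟨T₁, T₂, e, h₁, h₂⟩
    refine ⟨T₁ ∩ T, T₂ ∩ T, Set.inter_subset_right, Set.inter_subset_right, ?_,
      gsat_mono Set.inter_subset_left h₁, gsat_mono Set.inter_subset_left h₂⟩
    rw [← Set.union_inter_distrib_right]
    exact Set.inter_eq_right.2 e

theorem gsat_or_single {b : Bool} {φ ψ : Fml σ b} {a : Sem σ} :
    GSat {a} (or φ ψ) ↔ GSat {a} φ ∨ GSat {a} ψ := by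
  constructor
  · rintro ⟨T₁, T₂, -, -, e, h₁, h₂⟩
    have : a ∈ T₁ ∪ T₂ := e ▸ rfl
    exact this.imp (fun h => gsat_mono (Set.singleton_subset_iff.2 h) h₁)
      (fun h => gsat_mono (Set.singleton_subset_iff.2 h) h₂)
  · rintro (h | h)
    · exact gsat_or_left h
    · exact gsat_or_right h

theorem gsat_neg_single {b : Bool} {α : CO σ} {a : Sem σ} :
    GSat {a} (neg α : Fml σ b) ↔ ¬ GSat {a} α :=
  ⟨fun h => h a rfl, fun h => by rintro _ rfl; exact h⟩

theorem gsat_atom_single {b : Bool} {X : σ.Var} {x : σ.Ran X} {a : Sem σ} :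
    GSat {a} (atom X x : Fml σ b) ↔ a.1.1 X = x :=
  ⟨fun h => h a rfl, fun h => by rintro _ rfl; exact h⟩

theorem gsat_con {X : σ.Var} {T : GTeam σ} :
    GSat T (con X) ↔ ∀ a ∈ T, ∀ a' ∈ T, a.1.1 X = a'.1.1 X := by
  simp [con, GSat]

theorem exists_gsat_atom {X : σ.Var} {T : GTeam σ} (h : GSat T (con X)) :
    ∃ x, GSat T (atom X x : COD σ) := by
  rcases T.eq_empty_or_nonempty with rfl | ⟨a, ha⟩
  · exact ⟨Classical.arbitrary _, gsat_empty _⟩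
  · exact ⟨a.1.1 X, fun a' ha' => gsat_con.1 h a' ha' a ha⟩

theorem box_of_ne {b : Bool} {M : Multiset (Eqn σ)} (h : M ≠ 0) (φ : Fml σ b) :
    box M φ = cf M h φ := dif_neg h

theorem box_zero {b : Bool} (φ : Fml σ b) : box 0 φ = φ := dif_pos rfl

theorem gsat_box {b : Bool} {M : Multiset (Eqn σ)} {φ : Fml σ b} {T : GTeam σ} :
    GSat T (box M φ) ↔ ¬ Consistent M ∨ GSat (Sem.intervene M '' T) φ := by
  by_cases h : M = 0
  · subst h
    have : Sem.intervene (0 : Multiset (Eqn σ)) = id := funext Sem.intervene_zero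
    simp [box_zero, consistent_zero, this]
  · rw [box_of_ne h]
    rfl

theorem gsat_box_of_consistent {b : Bool} {M : Multiset (Eqn σ)} (hM : Consistent M)
    {φ : Fml σ b} {T : GTeam σ} : GSat T (box M φ) ↔ GSat (Sem.intervene M '' T) φ := by
  simp [gsat_box, hM]

theorem gsat_box_atom_single {b : Bool} {M : Multiset (Eqn σ)} (hM : Consistent M) {X : σ.Var}
    {x : σ.Ran X} {a : Sem σ} : GSat {a} (box M (atom X x) : Fml σ b) ↔ a.val M X = x := by
  rw [gsat_box_of_consistent hM, Set.image_singleton, gsat_atom_single]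

theorem gsat_andList {b : Bool} {l : List (Fml σ b)} {T : GTeam σ} :
    GSat T (andList l) ↔ ∀ φ ∈ l, GSat T φ := by
  induction l with
  | nil => simp [andList, gsat_top]
  | cons φ l ih =>
    cases l with
    | nil => simp [andList]
    | cons ψ l =>
      rw [List.forall_mem_cons, ← ih]
      rfl

theorem gsat_bigAnd {ι : Type*} [Finite ι] {b : Bool} {f : ι → Fml σ b} {T : GTeam σ} :
    GSat T (bigAnd f) ↔ ∀ i, GSat T (f i) := by
  simp [bigAnd, gsat_andList, mem_enum]

theorem gsat_orList_single {b : Bool} {l : List (Fml σ b)} {a : Sem σ} :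
    GSat {a} (orList l) ↔ ∃ φ ∈ l, GSat {a} φ := by
  induction l with
  | nil => simp [orList, gsat_bot]
  | cons φ l ih =>
    cases l with
    | nil => simp [orList]
    | cons ψ l =>
      rw [List.exists_mem_cons_iff, ← ih]
      exact gsat_or_single

theorem gsat_bigOr_single {ι : Type*} [Finite ι] {b : Bool} {f : ι → Fml σ b} {a : Sem σ} :
    GSat {a} (bigOr f) ↔ ∃ i, GSat {a} (f i) := by
  simp [bigOr, gsat_orList_single, mem_enum]

theorem exists_cover_of_gsat_bigOr {ι : Type*} [Finite ι] {b : Bool} {f : ι → Fml σ b}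
    {T : GTeam σ} (h : GSat T (bigOr f)) :
    ∃ S : ι → GTeam σ, (∀ i, GSat (S i) (f i)) ∧ ∀ a ∈ T, ∃ i, a ∈ S i := by
  classical
  -- Without repetitions in the list, each index receives exactly one part of the cover; two parts
  -- for the same index could not be merged, as satisfaction is not closed under unions.
  suffices H : ∀ (l : List ι), l.Nodup → ∀ (T : GTeam σ), GSat T (orList (l.map f)) →
      ∃ S : ι → GTeam σ, (∀ i, GSat (S i) (f i)) ∧ ∀ a ∈ T, ∃ i ∈ l, a ∈ S i by
    obtain ⟨S, hS, hT⟩ := H _ (Finset.nodup_toList _) T h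
    exact ⟨S, hS, fun a ha => (hT a ha).imp fun i hi => hi.2⟩
  clear h T
  intro l hl
  induction l with
  | nil =>
    intro T h
    refine ⟨fun _ => ∅, fun i => gsat_empty _, fun a ha => ?_⟩
    rw [gsat_bot.1 h] at ha
    exact ha.elim
  | cons i l ih =>
    intro T h
    cases l with
    | nil =>
      refine ⟨fun j => if j = i then T else ∅, fun j => ?_, fun a ha => ⟨i, by simp, by simpa⟩⟩
      by_cases hj : j = i
      · subst hj
        simpa [orList] using h
      · simpa [hj] using gsat_empty _
    | cons k l =>
      obtain ⟨T₁, T₂, -, -, e, h₁, h₂⟩ := h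
      obtain ⟨S, hS, hT⟩ := ih (List.nodup_cons.1 hl).2 T₂ h₂
      refine ⟨fun j => if j = i then T₁ else S j, fun j => ?_, fun a ha => ?_⟩
      · by_cases hj : j = i
        · subst hj
          simpa using h₁
        · simpa [hj] using hS j
      · rw [← e] at ha
        rcases ha with ha | ha
        · exact ⟨i, List.mem_cons_self, by simpa using ha⟩
        · obtain ⟨j, hj, haj⟩ := hT a ha
          have : j ≠ i := fun e => (List.nodup_cons.1 hl).1 (e ▸ hj)
          exact ⟨j, List.mem_cons_of_mem _ hj, by simpa [this] using haj⟩

/-! ### Soundness -/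

/-- Satisfaction is invariant under replacing models by models that are related by `P`, for
formulas without counterfactuals if `P` preserves the assignment, and for all formulas if `P` is
moreover preserved under interventions. -/
theorem gsat_image_congr {P : Sem σ → Sem σ → Prop} (hsymm : ∀ a b, P a b → P b a)
    (hP : ∀ a b, P a b → a.1.1 = b.1.1) {b : Bool} {γ : Fml σ b}
    (hγ : γ.BoxFree ∨ ∀ a b M, Consistent M → P a b → P (a.intervene M) (b.intervene M))
    {T : GTeam σ} {g h : Sem σ → Sem σ} (e : ∀ a ∈ T, P (g a) (h a)) (hT : GSat (g '' T) γ) :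
    GSat (h '' T) γ := by
  induction γ generalizing T g h with
  | atom X x =>
    rintro _ ⟨a, ha, rfl⟩
    rw [← hP _ _ (e a ha)]
    exact hT _ ⟨a, ha, rfl⟩
  | dep Xs Y =>
    rintro _ ⟨a, ha, rfl⟩ _ ⟨a', ha', rfl⟩
    rw [← hP _ _ (e a ha), ← hP _ _ (e a' ha')]
    exact hT _ ⟨a, ha, rfl⟩ _ ⟨a', ha', rfl⟩
  | neg α ih =>
    rintro _ ⟨a, ha, rfl⟩ hα
    refine hT _ ⟨a, ha, rfl⟩ ?_
    -- Negation swaps the roles of the two maps, which is why `P` has to be symmetric.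
    have := ih hγ (T := {a}) (g := h) (h := g) (by rintro _ rfl; exact hsymm _ _ (e _ ha))
      (by rwa [Set.image_singleton])
    rwa [Set.image_singleton] at this
  | and φ ψ ih₁ ih₂ =>
    exact ⟨ih₁ (hγ.imp_left And.left) e hT.1, ih₂ (hγ.imp_left And.right) e hT.2⟩
  | or φ ψ ih₁ ih₂ =>
    obtain ⟨T₁, T₂, -, -, eT, h₁, h₂⟩ := hT
    -- The splitting of `g '' T` is pulled back to the index set `T` and pushed forward along `h`.
    refine gsat_or_iff.2 ⟨h '' {a ∈ T | g a ∈ T₁}, h '' {a ∈ T | g a ∈ T₂}, ?_,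
      ih₁ (hγ.imp_left And.left) (fun a ha => e a ha.1) (gsat_mono ?_ h₁),
      ih₂ (hγ.imp_left And.right) (fun a ha => e a ha.1) (gsat_mono ?_ h₂)⟩
    · rintro _ ⟨a, ha, rfl⟩
      have : g a ∈ T₁ ∪ T₂ := eT ▸ ⟨a, ha, rfl⟩
      exact this.imp (fun h => ⟨a, ⟨ha, h⟩, rfl⟩) (fun h => ⟨a, ⟨ha, h⟩, rfl⟩)
    · rintro _ ⟨a, ha, rfl⟩
      exact ha.2
    · rintro _ ⟨a, ha, rfl⟩
      exact ha.2
  | cf M hM φ ih =>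
    have hγ := hγ.resolve_left id
    rw [← box_of_ne hM, gsat_box] at hT ⊢
    by_cases hc : Consistent M
    · have hT := hT.resolve_left (not_not_intro hc)
      rw [Set.image_image] at hT ⊢
      exact .inr (ih (.inr hγ) (fun a ha => hγ _ _ M hc (e a ha)) hT)
    · exact .inl hc

/-- A change at `X` propagates only along directed paths: if `V` is no descendant of `X`, then
neither is any parent of `V`, and none of them is `X` itself. -/
theorem Sem.val_singleton_congr (a : Sem σ) {X : σ.Var} (x x' : σ.Ran X) (V : σ.Var)
    (hVX : V ≠ X) (hV : ¬ Relation.TransGen a.1.2.Edge X V) :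
    a.val {⟨X, x⟩} V = a.val {⟨X, x'⟩} V := by
  induction V using a.2.1.wf.induction with
  | _ V ih =>
    have hn : ∀ x : σ.Ran X, ¬ ∃ y : σ.Ran V, (⟨V, y⟩ : Eqn σ) ∈ ({⟨X, x⟩} : Multiset (Eqn σ)) := by
      rintro x ⟨y, hy⟩
      exact hVX (congrArg Sigma.fst (Multiset.mem_singleton.1 hy))
    rcases hm : a.1.2 V with _ | m
    · rw [a.val_none (hn x) hm, a.val_none (hn x') hm]
    · rw [a.val_some (hn x) hm, a.val_some (hn x') hm]
      refine congrArg m.2 (funext fun P => ?_)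
      have hP : a.1.2.Edge P V := ⟨m, hm, P.2⟩
      refine ih P hP ?_ fun h => hV (h.tail hP)
      intro e
      rw [e] at hP
      exact hV (.single hP)

theorem consistent_singleton (p : Eqn σ) : Consistent ({p} : Multiset (Eqn σ)) := by
  intro X x x' h h'
  have := (Multiset.mem_singleton.1 h).trans (Multiset.mem_singleton.1 h').symm
  simpa using this

theorem transGen_of_gsat_affects {a : Sem σ} {X Y : σ.Var} (hXY : X ≠ Y)
    (h : GSat {a} (affects X Y)) : Relation.TransGen a.1.2.Edge X Y := by
  obtain ⟨⟨⟨⟨Z, z⟩, ⟨x, x'⟩, y, y'⟩, ⟨hX, hY⟩, hx, hy⟩, h⟩ := gsat_bigOr_single.1 h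
  rw [gsat_box_of_consistent (consistent_eqns _ _), Set.image_singleton] at h
  have h₁ := (gsat_box_atom_single (consistent_singleton _)).1 h.1
  have h₂ := (gsat_box_atom_single (consistent_singleton _)).1 h.2
  by_contra hn
  refine hy (h₁.symm.trans (Eq.trans ?_ h₂))
  refine Sem.val_singleton_congr _ _ _ Y hXY.symm fun ht => hn ?_
  -- Intervening on `Z` only deletes edges, so a path in the restricted graph is a path in the
  -- original one.
  refine Relation.TransGen.mono ?_ X Y ht
  rintro A B ⟨m, hm, hA⟩
  refine ⟨m, ?_, hA⟩
  by_cases hB : ∃ x : σ.Ran B, (⟨B, x⟩ : Eqn σ) ∈ eqns Z z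
  · exact absurd ((Sys.restrict_of_mem _ hB).symm.trans hm) (by simp)
  · exact (Sys.restrict_of_notMem _ hB).symm.trans hm

/-- Since the hole is under no negation, it is evaluated on one team, reached from `T` by splittings
and interventions. On that team `X` has a single value. -/
theorem exists_gsat_fill_atom {X : σ.Var} {C : Ctx σ} {T : GTeam σ}
    (h : GSat T (C.fill (con X))) : ∃ x, GSat T (C.fill (atom X x)) := by
  induction C generalizing T with
  | hole => exact exists_gsat_atom h
  | andL C ψ ih => exact (ih h.1).imp fun x hx => ⟨hx, h.2⟩
  | andR φ C ih => exact (ih h.2).imp fun x hx => ⟨h.1, hx⟩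
  | orL C ψ ih =>
    obtain ⟨T₁, T₂, s₁, s₂, e, h₁, h₂⟩ := h
    exact (ih h₁).imp fun x hx => ⟨T₁, T₂, s₁, s₂, e, hx, h₂⟩
  | orR φ C ih =>
    obtain ⟨T₁, T₂, s₁, s₂, e, h₁, h₂⟩ := h
    exact (ih h₂).imp fun x hx => ⟨T₁, T₂, s₁, s₂, e, h₁, hx⟩
  | cf M hM C ih =>
    by_cases hc : Consistent M
    · exact (ih (h.resolve_left (not_not_intro hc))).imp fun x hx => .inr hx
    · exact ⟨Classical.arbitrary _, .inl hc⟩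

/-- An intervention acts on each model separately, so splittings can be taken to preimages and
images. -/
theorem gsat_box_or_iff {b : Bool} {M : Multiset (Eqn σ)} {φ ψ : Fml σ b} {T : GTeam σ} :
    GSat T (box M (or φ ψ)) ↔ GSat T (or (box M φ) (box M ψ)) := by
  by_cases hM : Consistent M
  · simp only [gsat_or_iff, gsat_box_of_consistent hM]
    constructor
    · rintro ⟨T₁, T₂, e, h₁, h₂⟩
      refine ⟨Sem.intervene M ⁻¹' T₁, Sem.intervene M ⁻¹' T₂, fun a ha => e ⟨a, ha, rfl⟩,
        gsat_mono (Set.image_preimage_subset _ _) h₁, gsat_mono (Set.image_preimage_subset _ _) h₂⟩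
    · rintro ⟨T₁, T₂, e, h₁, h₂⟩
      refine ⟨_, _, ?_, h₁, h₂⟩
      rw [← Set.image_union]
      exact Set.image_mono e
  · exact iff_of_true (gsat_box.2 (.inl hM)) (gsat_or_left (gsat_box.2 (.inl hM)))

theorem gsat_box_congr {b : Bool} {M N : Multiset (Eqn σ)} (h : ∀ p, p ∈ M ↔ p ∈ N)
    {φ : Fml σ b} {T : GTeam σ} : GSat T (box M φ) ↔ GSat T (box N φ) := by
  have hc : Consistent M ↔ Consistent N :=
    ⟨fun hM => hM.mono fun p hp => (h p).2 hp, fun hN => hN.mono fun p hp => (h p).1 hp⟩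
  rw [gsat_box, gsat_box, hc]
  refine or_congr_right' fun hn => ?_
  rw [not_not] at hn
  have : Sem.intervene M = Sem.intervene N :=
    funext fun a => Sem.intervene_congr a (hc.2 hn) h
  rw [this]

/-- Soundness over a class of generalized causal teams that is closed under subteams and
interventions and on which the axioms are valid. -/
theorem Derives.sound {Ax : Set (COD σ)} {K : Set (GTeam σ)}
    (hsub : ∀ T ∈ K, ∀ S ⊆ T, S ∈ K) (hint : ∀ T ∈ K, ∀ M, Sem.intervene M '' T ∈ K)
    (hAx : ∀ φ ∈ Ax, ∀ T ∈ K, GSat T φ) {Γ : Set (COD σ)} {ψ : COD σ} (h : Derives Ax Γ ψ) :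
    ∀ T ∈ K, (∀ φ ∈ Γ, GSat T φ) → GSat T ψ := by
  have sub : ∀ {T S : GTeam σ} {Γ : Set (COD σ)}, S ⊆ T → (∀ φ ∈ Γ, GSat T φ) →
      ∀ φ ∈ Γ, GSat S φ := fun hS h φ hφ => gsat_mono hS (h φ hφ)
  have ins : ∀ {T : GTeam σ} {Γ : Set (COD σ)} {χ : COD σ}, GSat T χ → (∀ φ ∈ Γ, GSat T φ) →
      ∀ φ ∈ insert χ Γ, GSat T φ := fun hχ h φ hφ => by
    rcases hφ with rfl | hφ
    · exact hχ
    · exact h φ hφ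
  induction h with
  | hyp hφ => exact fun T _ h => h _ hφ
  | ax hφ => exact fun T hT _ => hAx _ hφ T hT
  | valDef X =>
    intro T _ _
    -- Flatness is available only for the `CO` version of the disjunction, which is then carried
    -- over to `COD`.
    have := (gsat_flat (bigOr fun x : σ.Ran X => (atom X x : CO σ)) (T := T)).2 fun a _ =>
      gsat_bigOr_single.2 ⟨a.1.1 X, gsat_atom_single.2 rfl⟩
    suffices H : ∀ (l : List (σ.Ran X)) (T : GTeam σ), GSat T (orList (l.map fun x => (atom X x : CO σ))) →
        GSat T (orList (l.map fun x => (atom X x : COD σ))) from H _ T this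
    intro l
    induction l with
    | nil => exact fun _ => id
    | cons x l ih =>
      cases l with
      | nil => exact fun _ => id
      | cons y l =>
        rintro T ⟨T₁, T₂, s₁, s₂, e, h₁, h₂⟩
        exact ⟨T₁, T₂, s₁, s₂, e, h₁, ih T₂ h₂⟩
  | valUnq X x x' hx _ ih =>
    intro T hT h a ha
    rw [gsat_atom_single, ih T hT h a ha]
    exact hx
  | andI _ _ ih₁ ih₂ => exact fun T hT h => ⟨ih₁ T hT h, ih₂ T hT h⟩
  | andE₁ _ ih => exact fun T hT h => (ih T hT h).1
  | andE₂ _ ih => exact fun T hT h => (ih T hT h).2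
  | orI₁ _ ih => exact fun T hT h => gsat_or_left (ih T hT h)
  | orI₂ _ ih => exact fun T hT h => gsat_or_right (ih T hT h)
  | orE _ _ _ ih ih₁ ih₂ =>
    intro T hT h
    obtain ⟨T₁, T₂, s₁, s₂, e, h₁, h₂⟩ := ih T hT h
    have h₁ := ih₁ T₁ (hsub T hT _ s₁) (ins h₁ (sub s₁ h))
    have h₂ := ih₂ T₂ (hsub T hT _ s₂) (ins h₂ (sub s₂ h))
    rw [gsat_lift, gsat_flat] at h₁ h₂ ⊢
    intro a ha
    rw [← e] at ha
    exact ha.elim (h₁ a) (h₂ a)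
  | negI _ ih =>
    intro T hT h a ha hα
    have ha' := Set.singleton_subset_iff.2 ha
    exact Set.singleton_ne_empty a (gsat_bot.1 (ih {a} (hsub T hT _ ha')
      (ins (gsat_lift.2 hα) (sub ha' h))))
  | negE _ _ ih₁ ih₂ =>
    intro T hT h
    have h₁ := gsat_lift.1 (ih₁ T hT h)
    have h₂ := ih₂ T hT h
    have : T = ∅ := Set.eq_empty_of_forall_notMem fun a ha => h₂ a ha ((gsat_flat _).1 h₁ a ha)
    rw [this]
    exact gsat_empty _
  | raa _ ih =>
    intro T hT h
    rw [gsat_lift, gsat_flat]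
    intro a ha
    by_contra hα
    have ha' := Set.singleton_subset_iff.2 ha
    exact Set.singleton_ne_empty a (gsat_bot.1 (ih {a} (hsub T hT _ ha')
      (ins (gsat_neg_single.2 hα) (sub ha' h))))
  | boxEff M Y y =>
    intro T hT h
    by_cases hc : Consistent (M + {⟨Y, y⟩})
    · rw [gsat_box_of_consistent hc]
      rintro _ ⟨a, _, rfl⟩
      exact a.val_mem hc (by simp)
    · exact gsat_box.2 (.inl hc)
  | @boxCmp Γ γ M W w hγ _ _ ih₁ ih₂ =>
    intro T hT h
    by_cases hc : Consistent (M + {⟨W, w⟩})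
    · have hM : Consistent M := hc.mono fun p hp => Multiset.mem_add.2 (.inl hp)
      have h₁ := ih₁ T hT h
      have h₂ := ih₂ T hT h
      rw [gsat_box_of_consistent hM] at h₁ h₂
      rw [gsat_box_of_consistent hc]
      -- The two interventions yield the same assignments but may yield different systems of
      -- functions; a formula without counterfactuals does not see the difference.
      refine gsat_image_congr (P := fun a b => a.1.1 = b.1.1) (fun _ _ => Eq.symm) (fun _ _ => id)
        (.inl hγ) (fun a ha => ?_) h₂
      symm
      refine Sys.doAssign_unique a.2.1 hc ?_ ?_ ?_
      · intro V x hx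
        rcases Multiset.mem_add.1 hx with hx | hx
        · exact a.val_mem hM hx
        · cases Multiset.mem_singleton.1 hx
          exact h₁ _ ⟨a, ha, rfl⟩
      · intro V hV hn
        exact a.val_none (fun ⟨x, hx⟩ => hV ⟨x, Multiset.mem_add.2 (.inl hx)⟩) hn
      · intro V m hV hm
        exact a.val_some (fun ⟨x, hx⟩ => hV ⟨x, Multiset.mem_add.2 (.inl hx)⟩) hm
    · exact gsat_box.2 (.inl hc)
  | boxBotE hM _ ih =>
    intro T hT h
    have := ih T hT h
    rw [gsat_box_of_consistent hM, gsat_bot, Set.image_eq_empty] at this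
    rw [this]
    exact gsat_empty _
  | botBoxE M X x x' hx =>
    intro T _ _
    exact gsat_box.2 (.inl fun hc => hx (hc X x x' (by simp) (by simp)))
  | boxCtr _ ih =>
    exact fun T hT h => (gsat_box_congr (by simp)).1 (ih T hT h)
  | boxWk _ ih =>
    exact fun T hT h => (gsat_box_congr (by simp)).1 (ih T hT h)
  | boxSub _ _ ih₁ ih₂ =>
    intro T hT h
    refine gsat_box.2 ((gsat_box.1 (ih₁ T hT h)).imp_right fun h' => ih₂ _ (hint T hT _) ?_)
    rintro _ rfl
    exact h'
  | boxAndI _ _ ih₁ ih₂ =>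
    intro T hT h
    have h₁ := gsat_box.1 (ih₁ T hT h)
    have h₂ := gsat_box.1 (ih₂ T hT h)
    rw [gsat_box]
    rcases h₁ with h₁ | h₁
    · exact .inl h₁
    · exact h₂.imp_right fun h₂ => ⟨h₁, h₂⟩
  | boxOrDst _ ih => exact fun T hT h => gsat_box_or_iff.1 (ih T hT h)
  | boxOrDstInv _ ih => exact fun T hT h => gsat_box_or_iff.2 (ih T hT h)
  | @boxExtr Γ φ M N hM _ ih =>
    intro T hT h
    have h := ih T hT h
    rw [gsat_box_of_consistent hM, gsat_box, Set.image_image] at h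
    rw [gsat_box]
    by_cases hN : Consistent N
    · right
      have h := h.resolve_left (not_not_intro hN)
      simpa only [Sem.intervene_intervene _ hM hN] using h
    · exact .inl fun hc => hN (hc.mono fun p hp => Multiset.mem_add.2 (.inr hp))
  | @boxExp Γ φ M N hd _ ih =>
    intro T hT h
    have h := ih T hT h
    by_cases hM : Consistent M
    · rw [gsat_box_of_consistent hM, gsat_box, Set.image_image]
      by_cases hN : Consistent N
      · right
        have hc : Consistent (M + N) := by
          intro X x x' hx hx'
          rcases Multiset.mem_add.1 hx with hx | hx <;> rcases Multiset.mem_add.1 hx' with hx' | hx'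
          · exact hM X x x' hx hx'
          · exact absurd rfl (hd ⟨X, x⟩ hx ⟨X, x'⟩ hx')
          · exact absurd rfl (hd ⟨X, x'⟩ hx' ⟨X, x⟩ hx)
          · exact hN X x x' hx hx'
        rw [gsat_box_of_consistent hc] at h
        simpa only [Sem.intervene_add _ hM hN hd] using h
      · exact .inl hN
    · exact gsat_box.2 (.inl hM)
  | negBoxE _ ih =>
    intro T hT h
    have h := ih T hT h
    rw [gsat_box, or_iff_not_imp_left, not_not]
    rintro hM _ ⟨a, ha, rfl⟩ hα
    refine h a ha ?_
    rwa [gsat_box_of_consistent hM, Set.image_singleton]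
  | @recur Γ k X hX _ ih =>
    intro T hT h a ha hl
    have hne : X (Fin.last (k + 1)) ≠ X 0 := fun e => (Fin.last_pos).ne' (hX e)
    have h₀ := transGen_of_gsat_affects hne hl
    have hi : ∀ i : Fin (k + 1), Relation.TransGen a.1.2.Edge (X i.castSucc) (X i.succ) := by
      intro i
      refine transGen_of_gsat_affects (fun e => (Fin.castSucc_lt_succ (i := i)).ne (hX e)) ?_
      exact (gsat_flat _).1 (gsat_lift.1 (ih i T hT h)) a ha
    have hc : ∀ i : Fin (k + 2), Relation.ReflTransGen a.1.2.Edge (X 0) (X i) := by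
      intro i
      induction i using Fin.induction with
      | zero => exact .refl
      | succ i ih => exact ih.trans (hi i).to_reflTransGen
    exact a.2.1 _ (h₀.trans_left (hc _))
  | orCom _ ih =>
    intro T hT h
    obtain ⟨T₁, T₂, s₁, s₂, e, h₁, h₂⟩ := ih T hT h
    exact ⟨T₂, T₁, s₂, s₁, (Set.union_comm _ _).trans e, h₂, h₁⟩
  | orAss _ ih =>
    intro T hT h
    obtain ⟨T₁, T₃, s₁, s₃, rfl, ⟨S₁, S₂, t₁, t₂, rfl, h₁, h₂⟩, h₃⟩ := ih T hT h
    refine gsat_or_iff.2 ⟨S₁, S₂ ∪ T₃, (Set.union_assoc _ _ _).le, h₁,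
      gsat_or_iff.2 ⟨S₂, T₃, subset_rfl, h₂, h₃⟩⟩
  | orSub _ _ ih₁ ih₂ =>
    intro T hT h
    obtain ⟨T₁, T₂, s₁, s₂, e, h₁, h₂⟩ := ih₁ T hT h
    exact ⟨T₁, T₂, s₁, s₂, e, ih₂ T₁ (hsub T hT _ s₁) (ins h₁ (sub s₁ h)), h₂⟩
  | depI₀ _ ih =>
    intro T hT h
    have h := ih T hT h
    exact gsat_con.2 fun a ha a' ha' => (h a ha).trans (h a' ha').symm
  | @depI Γ Xs Y _ ih =>
    intro T hT h a ha a' ha' e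
    -- A dependence atom concerns pairs only. On the pair `{a, a'}` the variables of `Xs` are
    -- constant, so the premise applies there.
    have hs : ({a, a'} : GTeam σ) ⊆ T := Set.insert_subset ha (Set.singleton_subset_iff.2 ha')
    refine gsat_con.1 (ih {a, a'} (hsub T hT _ hs) ?_) a (by simp) a' (by simp)
    rintro φ (hφ | ⟨X, hX, rfl⟩)
    · exact gsat_mono hs (h φ hφ)
    · rw [gsat_con]
      have := e X hX
      rintro _ (rfl | rfl) _ (rfl | rfl) <;> simp [this]
  | dep₀E C _ _ ih ih' =>
    intro T hT h
    obtain ⟨x, hx⟩ := exists_gsat_fill_atom (ih T hT h)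
    exact ih' x T hT (ins hx h)
  | depE _ _ ih₁ ih₂ =>
    intro T hT h
    exact gsat_con.2 fun a ha a' ha' => ih₁ T hT h a ha a' ha' fun X hX =>
      gsat_con.1 (ih₂ X hX T hT h) a ha a' ha'

theorem GDerives.sound {Γ : Set (COD σ)} {ψ : COD σ} (h : GDerives Γ ψ) : GEntails Γ ψ :=
  fun T => Derives.sound (K := Set.univ) (fun _ _ _ _ => trivial) (fun _ _ _ => trivial)
    (fun _ h => h.elim) h T trivial

/-! ### Causal models from families of intervened assignments -/

theorem exists_seq_of_transGen {α : Type*} {r : α → α → Prop} {x y : α}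
    (h : Relation.TransGen r x y) :
    ∃ (n : ℕ) (f : ℕ → α), 0 < n ∧ f 0 = x ∧ f n = y ∧ ∀ i < n, r (f i) (f (i + 1)) := by
  induction h with
  | @single y h =>
    refine ⟨1, fun i => if i = 0 then x else y, one_pos, rfl, rfl, fun i hi => ?_⟩
    obtain rfl : i = 0 := by omega
    exact h
  | @tail y z _ h ih =>
    obtain ⟨n, f, hn, h₀, h₁, hf⟩ := ih
    refine ⟨n + 1, fun i => if i ≤ n then f i else z, by omega, by simpa, by simp, fun i hi => ?_⟩
    rcases Nat.lt_succ_iff_lt_or_eq.1 hi with hi | rfl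
    · simpa [hi.le, Nat.succ_le_of_lt hi] using hf i hi
    · simpa [h₁] using h

/-- A shortest closed walk repeats no vertex, and irreflexivity excludes length one. This is the
shape of cycle that `recur` refutes. -/
theorem exists_injective_cycle {α : Type*} {r : α → α → Prop} (hr : ∀ x, ¬ r x x) {x : α}
    (h : Relation.TransGen r x x) : ∃ (k : ℕ) (X : Fin (k + 2) → α), Function.Injective X ∧
      (∀ i : Fin (k + 1), r (X i.castSucc) (X i.succ)) ∧ r (X (Fin.last (k + 1))) (X 0) := by
  classical
  have hex : ∃ n, ∃ f : ℕ → α, 0 < n ∧ f 0 = f n ∧ ∀ i < n, r (f i) (f (i + 1)) := by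
    obtain ⟨n, f, hn, h₀, h₁, hf⟩ := exists_seq_of_transGen h
    exact ⟨n, f, hn, h₀.trans h₁.symm, hf⟩
  obtain ⟨f, hn, h₀, hf⟩ := Nat.find_spec hex
  have hmin := fun m => Nat.find_min hex (m := m)
  generalize Nat.find hex = n at *
  have hinj : ∀ i j, i < j → j < n → f i ≠ f j := by
    intro i j hij hj e
    refine hmin (j - i) (by omega) ⟨fun m => f (i + m), by omega, ?_, fun m hm => ?_⟩
    · simpa [Nat.add_sub_cancel' hij.le] using e
    · exact hf (i + m) (by omega)
  match n, hn with
  | 1, _ => exact absurd (h₀ ▸ hf 0 one_pos) (hr _)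
  | k + 2, _ =>
    refine ⟨k, fun i => f i, ?_, fun i => ?_, ?_⟩
    · intro i j e
      rcases lt_trichotomy i j with hij | hij | hij
      · exact absurd e (hinj _ _ hij j.2)
      · exact hij
      · exact absurd e.symm (hinj _ _ hij i.2)
    · simpa using hf i (by omega)
    · simpa [h₀] using hf (k + 1) (by omega)

/-- The value of `V` when all the other variables are set according to `w`. -/
noncomputable def response (val : Multiset (Eqn σ) → Assign σ) (V : σ.Var) (w : Assign σ) :
    σ.Ran V := val (eqns (others V) fun X => w X) V

open Classical in
/-- The variables on which the response of `V` depends. -/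
def parents (val : Multiset (Eqn σ) → Assign σ) (V : σ.Var) : Set σ.Var :=
  {X | X ≠ V ∧ ∃ (w : Assign σ) (x : σ.Ran X),
    response val V w ≠ response val V (Function.update w X x)}

open Classical in
/-- An assignment that extends a tuple. -/
noncomputable def Tuple.extend {W : Set σ.Var} (w : Tuple W) : Assign σ :=
  fun X => if h : X ∈ W then w ⟨X, h⟩ else Classical.arbitrary _

theorem Tuple.extend_apply {W : Set σ.Var} (w : Tuple W) (X : W) : w.extend X = w X :=
  dif_pos X.2

theorem Tuple.extend_restrict {W : Set σ.Var} (w : Tuple W) : (fun X : W => w.extend X) = w :=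
  funext w.extend_apply

theorem response_congr_update (val : Multiset (Eqn σ) → Assign σ) (V : σ.Var) {w w' : Assign σ}
    (h : ∀ X, X ≠ V → w X = w' X) : response val V w = response val V w' := by
  unfold response
  congr 2
  funext X
  exact h X X.2

/-- One passes from `w` to `w'` by changing one variable at a time. At a parent nothing changes, and
by definition a change at a non-parent is not felt. -/
theorem response_congr (val : Multiset (Eqn σ) → Assign σ) (V : σ.Var) {w w' : Assign σ}
    (h : ∀ X ∈ parents val V, w X = w' X) : response val V w = response val V w' := by
  classical
  have := Fintype.ofFinite σ.Var
  suffices H : ∀ (S : Finset σ.Var) (w : Assign σ), (∀ X, X ∉ S → w X = w' X) →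
      (∀ X ∈ parents val V, w X = w' X) → response val V w = response val V w' from
    H Finset.univ w (by simp) h
  clear h w
  intro S
  induction S using Finset.induction_on with
  | empty =>
    intro w h _
    rw [funext fun X => h X (Finset.notMem_empty X)]
  | insert Y S hY ih =>
    intro w h hp
    have h' : response val V (Function.update w Y (w' Y)) = response val V w' := by
      refine ih _ (fun X hX => ?_) (fun X hX => ?_)
      · by_cases hXY : X = Y
        · subst hXY
          simp
        · rw [Function.update_of_ne hXY]
          exact h X (by simp [hXY, hX])
      · by_cases hXY : X = Y
        · subst hXY
          simp
        · rw [Function.update_of_ne hXY]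
          exact hp X hX
    rw [← h']
    by_cases hV : Y = V
    · refine response_congr_update val V fun X hX => ?_
      rw [Function.update_of_ne (hV ▸ hX)]
    · by_contra hne
      have : Y ∈ parents val V := ⟨hV, w, w' Y, hne⟩
      rw [← hp Y this, Function.update_eq_self] at hne
      exact hne rfl

/-- A family of assignments that is effective (the intervened variables have the intended values)
and closed under composition. -/
structure EffectiveFamily (val : Multiset (Eqn σ) → Assign σ) : Prop where
  eff : ∀ M, Consistent M → ∀ X x, (⟨X, x⟩ : Eqn σ) ∈ M → val M X = x
  cmp : ∀ M, Consistent M → ∀ W, val (M + {⟨W, val M W⟩}) = val M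

namespace EffectiveFamily

variable {val : Multiset (Eqn σ) → Assign σ}

/-- Iterated composition: setting variables to the values they already have after `M` changes
nothing. -/
theorem absorb (hval : EffectiveFamily val) {M : Multiset (Eqn σ)} (hM : Consistent M) (N : Multiset (Eqn σ))
    (h : ∀ p ∈ N, val M p.1 = p.2) : val (M + N) = val M := by
  induction N using Multiset.induction_on with
  | empty => rw [add_zero]
  | cons p N ih =>
    have e := ih fun q hq => h q (Multiset.mem_cons_of_mem hq)
    have hc : Consistent (M + N) := by
      refine consistent_of_assign (val M) fun q hq => ?_
      rcases Multiset.mem_add.1 hq with hq | hq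
      · exact hval.eff M hM _ _ hq
      · exact h q (Multiset.mem_cons_of_mem hq)
    have := hval.cmp (M + N) hc p.1
    rw [e, h p (Multiset.mem_cons_self p N)] at this
    rwa [← Multiset.singleton_add, add_comm {p} N, ← add_assoc]

theorem congr (hval : EffectiveFamily val) {M N : Multiset (Eqn σ)} (hM : Consistent M) (h : ∀ p, p ∈ M ↔ p ∈ N) :
    val M = val N := by
  have hN : Consistent N := hM.mono fun p hp => (h p).2 hp
  rw [← hval.absorb hM N fun p hp => hval.eff M hM _ _ ((h p).2 hp), add_comm,
    hval.absorb hN M fun p hp => hval.eff N hN _ _ ((h p).1 hp)]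

/-- By `absorb`, all variables other than `V` may be fixed at their values after `M`. The result is
an intervention of the kind that `response` records, so the whole family is governed by the
responses. -/
theorem eq_response (hval : EffectiveFamily val) {M : Multiset (Eqn σ)} (hM : Consistent M) {V : σ.Var}
    (hV : ¬ ∃ x : σ.Ran V, (⟨V, x⟩ : Eqn σ) ∈ M) : val M V = response val V (val M) := by
  unfold response
  have h : ∀ p ∈ eqns (others V) (fun X => val M X), val M p.1 = p.2 := by
    intro p hp
    obtain ⟨_, e⟩ := mem_eqns.1 hp
    exact e
  rw [hval.congr (consistent_eqns (others V) fun X => val M X)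
    (N := M + eqns (others V) fun X => val M X), hval.absorb hM _ h]
  intro p
  rw [Multiset.mem_add, iff_or_self]
  intro hp
  exact mem_eqns.2 ⟨fun e => hV ⟨e ▸ p.2, by rcases p with ⟨P, p⟩; cases e; exact hp⟩,
    hval.eff M hM _ _ hp⟩

/-- An effective and compositional family without cyclic dependence comes from a causal model. -/
theorem exists_model (hval : EffectiveFamily val)
    (hrec : ∀ (k : ℕ) (X : Fin (k + 2) → σ.Var), Function.Injective X →
      (∀ i : Fin (k + 1), X i.castSucc ∈ parents val (X i.succ)) →
        X (Fin.last (k + 1)) ∉ parents val (X 0)) :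
    ∃ a : Sem σ, ∀ M, Consistent M → a.val M = val M := by
  classical
  -- A variable without parents is made exogenous; unless it is itself intervened on, it keeps its
  -- value `val 0 V`.
  let F : Sys σ := fun V => if parents val V = ∅ then none else
    some ⟨⟨parents val V, fun h => h.1 rfl⟩, fun p => response val V p.extend⟩
  have hedge : ∀ {X V}, F.Edge X V → X ∈ parents val V := by
    rintro X V ⟨m, hm, hX⟩
    simp only [F] at hm
    split_ifs at hm
    cases hm
    exact hX
  have hF : F.Recursive := by
    intro X hX
    obtain ⟨k, Y, hY, hc, hl⟩ := exists_injective_cycle (fun x hx => (hedge hx).1 rfl) hX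
    exact hrec k Y hY (fun i => hedge (hc i)) (hedge hl)
  have hsome : ∀ {M} (_ : Consistent M) V (m : Law V), (¬ ∃ x : σ.Ran V, (⟨V, x⟩ : Eqn σ) ∈ M) →
      F V = some m → val M V = m.2 (fun X => val M X) := by
    intro M hM V m hV hm
    rw [hval.eq_response hM hV]
    simp only [F] at hm
    split_ifs at hm
    cases hm
    refine response_congr val V fun X hX => ?_
    exact (Tuple.extend_apply (W := parents val V) (fun X => val M X) ⟨X, hX⟩).symm
  refine ⟨⟨(val 0, F), hF, fun V m hm => hsome consistent_zero V m (by simp) hm⟩, fun M hM => ?_⟩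
  refine Sys.doAssign_unique hF hM (hval.eff M hM) ?_ (hsome hM)
  intro V hV hn
  have hp : parents val V = ∅ := by
    simp only [F] at hn
    split_ifs at hn with h
    exact h
  change val M V = val 0 V
  rw [hval.eq_response hM hV, hval.eq_response consistent_zero (V := V) (by simp)]
  refine response_congr val V fun X hX => ?_
  rw [hp] at hX
  exact hX.elim

end EffectiveFamily

/-! ### Structural rules and derived rules -/

namespace Fml

theorem lift_box {b : Bool} (M : Multiset (Eqn σ)) (φ : Fml σ b) :
    (box M φ).lift = box M φ.lift := by
  by_cases h : M = 0
  · subst h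
    rw [box_zero, box_zero]
  · rw [box_of_ne h, box_of_ne h]
    rfl

theorem lift_orList {b : Bool} (l : List (Fml σ b)) :
    (orList l).lift = orList (l.map lift) := by
  induction l with
  | nil => rfl
  | cons φ l ih =>
    cases l with
    | nil => rfl
    | cons ψ l => exact congrArg (or φ.lift) ih

end Fml

namespace Derives

variable {Ax : Set (COD σ)} {Γ Δ : Set (COD σ)} {φ ψ χ : COD σ}

theorem mono {Ax' : Set (COD σ)} (hAx : Ax ⊆ Ax') (h : Derives Ax Γ ψ) (hΓ : Γ ⊆ Δ) :
    Derives Ax' Δ ψ := by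
  induction h generalizing Δ with
  | hyp h => exact hyp (hΓ h)
  | ax h => exact ax (hAx h)
  | valDef X => exact valDef X
  | valUnq X x x' hx _ ih => exact valUnq X x x' hx (ih hΓ)
  | andI _ _ ih₁ ih₂ => exact andI (ih₁ hΓ) (ih₂ hΓ)
  | andE₁ _ ih => exact andE₁ (ih hΓ)
  | andE₂ _ ih => exact andE₂ (ih hΓ)
  | orI₁ _ ih => exact orI₁ (ih hΓ)
  | orI₂ _ ih => exact orI₂ (ih hΓ)
  | orE _ _ _ ih ih₁ ih₂ =>
    exact orE (ih hΓ) (ih₁ (Set.insert_subset_insert hΓ)) (ih₂ (Set.insert_subset_insert hΓ))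
  | negI _ ih => exact negI (ih (Set.insert_subset_insert hΓ))
  | negE _ _ ih₁ ih₂ => exact negE (ih₁ hΓ) (ih₂ hΓ)
  | raa _ ih => exact raa (ih (Set.insert_subset_insert hΓ))
  | boxEff M Y y => exact boxEff M Y y
  | boxCmp h _ _ ih₁ ih₂ => exact boxCmp h (ih₁ hΓ) (ih₂ hΓ)
  | boxBotE h _ ih => exact boxBotE h (ih hΓ)
  | botBoxE M X x x' h => exact botBoxE M X x x' h
  | boxCtr _ ih => exact boxCtr (ih hΓ)
  | boxWk _ ih => exact boxWk (ih hΓ)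
  | boxSub _ _ ih₁ ih₂ => exact boxSub (ih₁ hΓ) (ih₂ subset_rfl)
  | boxAndI _ _ ih₁ ih₂ => exact boxAndI (ih₁ hΓ) (ih₂ hΓ)
  | boxOrDst _ ih => exact boxOrDst (ih hΓ)
  | boxOrDstInv _ ih => exact boxOrDstInv (ih hΓ)
  | boxExtr h _ ih => exact boxExtr h (ih hΓ)
  | boxExp h _ ih => exact boxExp h (ih hΓ)
  | negBoxE _ ih => exact negBoxE (ih hΓ)
  | recur X hX _ ih => exact recur X hX fun i => ih i hΓ
  | orCom _ ih => exact orCom (ih hΓ)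
  | orAss _ ih => exact orAss (ih hΓ)
  | orSub _ _ ih₁ ih₂ => exact orSub (ih₁ hΓ) (ih₂ (Set.insert_subset_insert hΓ))
  | depI₀ _ ih => exact depI₀ (ih hΓ)
  | depI _ ih => exact depI (ih (Set.union_subset_union_left _ hΓ))
  | dep₀E C _ _ ih ih' => exact dep₀E C (ih hΓ) fun x => ih' x (Set.insert_subset_insert hΓ)
  | depE _ _ ih ih' => exact depE (ih hΓ) fun X hX => ih' X hX hΓ

theorem weaken (h : Derives Ax Γ ψ) (hΓ : Γ ⊆ Δ) : Derives Ax Δ ψ := h.mono subset_rfl hΓ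

theorem wk (h : Derives Ax Γ ψ) : Derives Ax (insert φ Γ) ψ := h.weaken (Set.subset_insert _ _)

theorem hyp₀ : Derives Ax (insert φ Γ) φ := hyp (Set.mem_insert _ _)

theorem forall_insert (h : ∀ φ ∈ Γ, Derives Ax Δ φ) (χ : COD σ) :
    ∀ φ ∈ insert χ Γ, Derives Ax (insert χ Δ) φ := by
  rintro φ (rfl | hφ)
  · exact hyp₀
  · exact (h φ hφ).wk

theorem cut (hΓ : ∀ φ ∈ Γ, Derives Ax Δ φ) (h : Derives Ax Γ ψ) : Derives Ax Δ ψ := by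
  induction h generalizing Δ with
  | hyp h => exact hΓ _ h
  | ax h => exact ax h
  | valDef X => exact valDef X
  | valUnq X x x' hx _ ih => exact valUnq X x x' hx (ih hΓ)
  | andI _ _ ih₁ ih₂ => exact andI (ih₁ hΓ) (ih₂ hΓ)
  | andE₁ _ ih => exact andE₁ (ih hΓ)
  | andE₂ _ ih => exact andE₂ (ih hΓ)
  | orI₁ _ ih => exact orI₁ (ih hΓ)
  | orI₂ _ ih => exact orI₂ (ih hΓ)
  | orE _ _ _ ih ih₁ ih₂ =>
    exact orE (ih hΓ) (ih₁ (forall_insert hΓ _)) (ih₂ (forall_insert hΓ _))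
  | negI _ ih => exact negI (ih (forall_insert hΓ _))
  | negE _ _ ih₁ ih₂ => exact negE (ih₁ hΓ) (ih₂ hΓ)
  | raa _ ih => exact raa (ih (forall_insert hΓ _))
  | boxEff M Y y => exact boxEff M Y y
  | boxCmp h _ _ ih₁ ih₂ => exact boxCmp h (ih₁ hΓ) (ih₂ hΓ)
  | boxBotE h _ ih => exact boxBotE h (ih hΓ)
  | botBoxE M X x x' h => exact botBoxE M X x x' h
  | boxCtr _ ih => exact boxCtr (ih hΓ)
  | boxWk _ ih => exact boxWk (ih hΓ)
  -- The subderivation has no open assumption from `Γ`, so it is kept unchanged.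
  | boxSub _ h ih _ => exact boxSub (ih hΓ) h
  | boxAndI _ _ ih₁ ih₂ => exact boxAndI (ih₁ hΓ) (ih₂ hΓ)
  | boxOrDst _ ih => exact boxOrDst (ih hΓ)
  | boxOrDstInv _ ih => exact boxOrDstInv (ih hΓ)
  | boxExtr h _ ih => exact boxExtr h (ih hΓ)
  | boxExp h _ ih => exact boxExp h (ih hΓ)
  | negBoxE _ ih => exact negBoxE (ih hΓ)
  | recur X hX _ ih => exact recur X hX fun i => ih i hΓ
  | orCom _ ih => exact orCom (ih hΓ)
  | orAss _ ih => exact orAss (ih hΓ)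
  | orSub _ _ ih₁ ih₂ => exact orSub (ih₁ hΓ) (ih₂ (forall_insert hΓ _))
  | depI₀ _ ih => exact depI₀ (ih hΓ)
  | depI _ ih =>
    refine depI (ih ?_)
    rintro χ (hχ | hχ)
    · exact (hΓ χ hχ).weaken Set.subset_union_left
    · exact hyp (.inr hχ)
  | dep₀E C _ _ ih ih' => exact dep₀E C (ih hΓ) fun x => ih' x (forall_insert hΓ _)
  | depE _ _ ih ih' => exact depE (ih hΓ) fun X hX => ih' X hX hΓ

theorem trans (h : Derives Ax Γ φ) (h' : Derives Ax (insert φ Γ) ψ) : Derives Ax Γ ψ := by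
  refine cut ?_ h'
  rintro χ (rfl | hχ)
  · exact h
  · exact hyp hχ

theorem trans_single (h : Derives Ax Γ φ) (h' : Derives Ax {φ} ψ) : Derives Ax Γ ψ :=
  cut (by rintro _ rfl; exact h) h'

theorem orList_intro {l : List (COD σ)} (hφ : φ ∈ l) (h : Derives Ax Γ φ) :
    Derives Ax Γ (orList l) := by
  induction l with
  | nil => cases hφ
  | cons χ l ih =>
    cases l with
    | nil =>
      rw [List.mem_singleton.1 hφ] at h
      exact h
    | cons ψ l =>
      rcases List.mem_cons.1 hφ with rfl | hφ
      · exact orI₁ h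
      · exact orI₂ (ih hφ)

theorem bigOr_lift_intro {ι : Type*} [Finite ι] {f : ι → CO σ} (i : ι)
    (h : Derives Ax Γ (f i).lift) : Derives Ax Γ (bigOr f).lift := by
  unfold bigOr
  rw [lift_orList, List.map_map]
  exact orList_intro (List.mem_map_of_mem (mem_enum i)) h

theorem andList_intro {l : List (COD σ)} (h : ∀ φ ∈ l, Derives Ax Γ φ) :
    Derives Ax Γ (andList l) := by
  induction l with
  | nil => exact negI (α := bot) hyp₀
  | cons χ l ih =>
    cases l with
    | nil => exact h χ List.mem_cons_self
    | cons ψ l =>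
      exact andI (h χ List.mem_cons_self) (ih fun φ hφ => h φ (List.mem_cons_of_mem _ hφ))

/-! ### Derived rules for counterfactuals -/

/-- Effectiveness provides some provable consequent, which `boxSub` then replaces by the theorem
`χ`. -/
theorem boxNec (M : Multiset (Eqn σ)) (h : ∀ Δ, Derives Ax Δ χ) : Derives Ax Γ (box M χ) := by
  by_cases hM : M = 0
  · subst hM
    rw [box_zero]
    exact h Γ
  · obtain ⟨p, hp⟩ := Multiset.exists_mem_of_ne_zero hM
    obtain ⟨M, rfl⟩ := Multiset.exists_cons_of_mem hp
    rw [← Multiset.singleton_add, add_comm]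
    exact boxSub (boxEff M p.1 p.2) (h _)

theorem boxOrList_elim {M : Multiset (Eqn σ)} {α : CO σ} {l : List (COD σ)} (hl : l ≠ [])
    (h : Derives Ax Γ (box M (orList l)))
    (h' : ∀ φ ∈ l, Derives Ax (insert (box M φ) Γ) α.lift) : Derives Ax Γ α.lift := by
  induction l generalizing Γ with
  | nil => exact absurd rfl hl
  | cons χ l ih =>
    cases l with
    | nil => exact h.trans (h' χ List.mem_cons_self)
    | cons ψ l =>
      refine orE (boxOrDst h) (h' χ List.mem_cons_self) (ih (by simp) hyp₀ fun φ hφ => ?_)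
      exact (h' φ (List.mem_cons_of_mem _ hφ)).weaken
        (Set.insert_subset_insert (Set.subset_insert _ _))

theorem box_atom_cases (M : Multiset (Eqn σ)) (X : σ.Var) {α : CO σ}
    (h : ∀ x, Derives Ax (insert (box M (atom X x)) Γ) α.lift) : Derives Ax Γ α.lift := by
  have hv : Derives Ax Γ (box M (bigOr fun x : σ.Ran X => atom X x)) :=
    boxNec M fun Δ => valDef X
  refine boxOrList_elim ?_ hv ?_
  -- Nonemptiness of the range matters: for inconsistent `M`, the empty disjunction `⊥` under `M`
  -- would give nothing.
  · intro e
    have := mem_enum (Classical.arbitrary (σ.Ran X))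
    rw [List.map_eq_nil_iff.1 e] at this
    cases this
  · intro φ hφ
    obtain ⟨x, -, rfl⟩ := List.mem_map.1 hφ
    exact h x

theorem box_cons_of_mem {M : Multiset (Eqn σ)} {e : Eqn σ} (he : e ∈ M) :
    Derives Ax Γ (box (e ::ₘ M) φ) ↔ Derives Ax Γ (box M φ) := by
  obtain ⟨M, rfl⟩ := Multiset.exists_cons_of_mem he
  simp only [← Multiset.singleton_add, ← add_assoc]
  exact ⟨boxCtr, boxWk⟩

theorem box_add_of_subset {M N : Multiset (Eqn σ)} (h : ∀ p ∈ N, p ∈ M) :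
    Derives Ax Γ (box (N + M) φ) ↔ Derives Ax Γ (box M φ) := by
  induction N using Multiset.induction_on with
  | empty => rw [zero_add]
  | cons p N ih =>
    rw [← ih fun q hq => h q (Multiset.mem_cons_of_mem hq), Multiset.cons_add]
    exact box_cons_of_mem (Multiset.mem_add.2 (.inr (h p (Multiset.mem_cons_self p N))))

theorem box_congr {M N : Multiset (Eqn σ)} (hMN : ∀ p, p ∈ M ↔ p ∈ N)
    (h : Derives Ax Γ (box M φ)) : Derives Ax Γ (box N φ) := by
  rw [← box_add_of_subset fun p hp => (hMN p).1 hp, add_comm]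
  exact (box_add_of_subset fun p hp => (hMN p).2 hp).2 h

theorem box_of_not_consistent {M : Multiset (Eqn σ)} (hM : ¬ Consistent M) :
    Derives Ax Γ (box M φ) := by
  simp only [Consistent, not_forall] at hM
  obtain ⟨X, x, x', hx, hx', hne⟩ := hM
  rw [← box_add_of_subset (M := M) (N := {⟨X, x⟩, ⟨X, x'⟩})]
  · have := botBoxE (Ax := Ax) (Γ := Γ) (φ := φ) M X x x' hne
    rwa [add_assoc, add_comm] at this
  · intro p hp
    simp only [Multiset.insert_eq_cons, Multiset.mem_cons, Multiset.mem_singleton] at hp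
    rcases hp with rfl | rfl
    · exact hx
    · exact hx'

theorem box_contradiction {M : Multiset (Eqn σ)} (hM : Consistent M) {α : CO σ}
    (h : Derives Ax Γ (box M α.lift)) (h' : Derives Ax Γ (box M (neg α))) : Derives Ax Γ ψ := by
  refine boxBotE hM (boxSub (boxAndI h h') ?_)
  exact negE (α := α) (andE₁ (hyp rfl)) (andE₂ (hyp rfl))

end Derives

/-! ### Deciding sets of formulas and their causal models -/

/-- `Γ` is consistent and decides the result of every intervention. -/
def Deciding (Ax Γ : Set (COD σ)) : Prop :=
  ¬ Derives Ax Γ bot ∧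
    ∀ M, Consistent M → ∀ X, ∃ x : σ.Ran X, Derives Ax Γ (box M (atom X x))

theorem exists_deciding {Ax Γ : Set (COD σ)} (hΓ : ¬ Derives Ax Γ bot) :
    ∃ Δ, Γ ⊆ Δ ∧ Deciding Ax Δ := by
  classical
  -- Up to order and repetition every consistent antecedent is some `W = w`. There are finitely many
  -- of these, so a finite induction replaces an appeal to maximal consistent sets.
  let ι := (Σ W : Set σ.Var, Tuple W) × σ.Var
  have := Fintype.ofFinite ι
  have key : ∀ s : Finset ι, ∃ Δ, Γ ⊆ Δ ∧ ¬ Derives Ax Δ bot ∧ ∀ i ∈ s,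
      ∃ x : σ.Ran i.2, Derives Ax Δ (box (eqns i.1.1 i.1.2) (atom i.2 x)) := by
    intro s
    induction s using Finset.induction_on with
    | empty => exact ⟨Γ, subset_rfl, hΓ, by simp⟩
    | insert i s _ ih =>
      obtain ⟨Δ, hΔ, hc, hs⟩ := ih
      obtain ⟨x, hx⟩ : ∃ x : σ.Ran i.2,
          ¬ Derives Ax (insert (box (eqns i.1.1 i.1.2) (atom i.2 x)) Δ) bot := by
        by_contra! h
        exact hc (Derives.box_atom_cases (α := bot) _ _ h)
      refine ⟨_, hΔ.trans (Set.subset_insert _ _), hx, fun j hj => ?_⟩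
      rcases Finset.mem_insert.1 hj with rfl | hj
      · exact ⟨x, .hyp₀⟩
      · exact (hs j hj).imp fun y hy => hy.wk
  obtain ⟨Δ, hΔ, hc, hs⟩ := key Finset.univ
  refine ⟨Δ, hΔ, hc, fun M hM X => ?_⟩
  let W : Set σ.Var := {Y | ∃ y : σ.Ran Y, (⟨Y, y⟩ : Eqn σ) ∈ M}
  let w : Tuple W := fun Y => Y.2.choose
  obtain ⟨x, hx⟩ := hs ⟨⟨W, w⟩, X⟩ (Finset.mem_univ _)
  refine ⟨x, hx.box_congr fun p => ?_⟩
  rw [mem_eqns]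
  constructor
  · rintro ⟨h, e⟩
    have := h.choose_spec
    rwa [show h.choose = p.2 from e] at this
  · intro hp
    have h : p.1 ∈ W := ⟨p.2, hp⟩
    exact ⟨h, hM _ _ _ h.choose_spec hp⟩

/-- Each semantic condition comes from a rule: effectiveness from `boxEff`, composition from
`boxCmp`, acyclicity from `recur`. -/
theorem Deciding.exists_model {Ax Γ : Set (COD σ)} (hΓ : Deciding Ax Γ) :
    ∃ a : Sem σ, ∀ M, Consistent M → ∀ X, Derives Ax Γ (box M (atom X (a.val M X))) := by
  classical
  obtain ⟨hc, hd⟩ := hΓ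
  choose! val hval using hd
  have huniq : ∀ M, Consistent M → ∀ X x, Derives Ax Γ (box M (atom X x)) → val M X = x := by
    intro M hM X x hx
    by_contra hne
    refine hc (Derives.box_contradiction hM (α := atom X x) hx ((hval M hM X).boxSub ?_))
    exact Derives.valUnq X _ _ hne (.hyp rfl)
  have heff : EffectiveFamily val := by
    refine ⟨fun M hM X x hx => huniq M hM X x ?_, fun M hM W => ?_⟩
    · obtain ⟨M, rfl⟩ := Multiset.exists_cons_of_mem hx
      rw [← Multiset.singleton_add, add_comm]
      exact .boxEff M X x
    · have hM' : Consistent (M + {⟨W, val M W⟩}) := by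
        refine consistent_of_assign (val M) fun p hp => ?_
        rcases Multiset.mem_add.1 hp with hp | hp
        · refine huniq M hM p.1 p.2 ?_
          obtain ⟨M, rfl⟩ := Multiset.exists_cons_of_mem hp
          rw [← Multiset.singleton_add, add_comm]
          exact .boxEff M _ _
        · cases Multiset.mem_singleton.1 hp
          rfl
      funext X
      exact huniq _ hM' X _ (.boxCmp trivial (hval M hM W) (hval M hM X))
  -- Two full settings that differ only at `X` and give `V` different values form a disjunct of
  -- `affects X V`, with `Z` all remaining variables; `boxExp` separates the equation for `X`.
  have haff : ∀ {X V}, X ∈ parents val V → Derives Ax Γ (affects X V).lift := by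
    rintro X V ⟨hXV, w, x, hne⟩
    have hx : w X ≠ x := fun e => by
      rw [← e, Function.update_eq_self] at hne
      exact hne rfl
    let z : Tuple ({X, V}ᶜ : Set σ.Var) := fun Y => w Y
    have hbox : ∀ x, Derives Ax Γ (box (eqns _ z)
        (box {⟨X, x⟩} (atom V (response val V (Function.update w X x))))) := by
      intro x
      refine .boxExp ?_ (.box_congr ?_ (hval (eqns (others V) fun Y => Function.update w X x Y)
        (consistent_eqns _ _) V))
      · intro p hp q hq
        cases Multiset.mem_singleton.1 hq
        obtain ⟨hp, -⟩ := mem_eqns.1 hp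
        exact fun e => hp (.inl e)
      · exact mem_eqns_update hXV w x
    refine Derives.bigOr_lift_intro ⟨⟨⟨_, z⟩, (w X, x), (_, _)⟩, ⟨?_, ?_⟩, hx, hne⟩ ?_
    · exact fun h => h (.inl rfl)
    · exact fun h => h (.inr rfl)
    · rw [lift_box]
      refine .boxAndI ?_ ?_
      · rw [lift_box]
        have := hbox (w X)
        rwa [Function.update_eq_self] at this
      · rw [lift_box]
        exact hbox x
  obtain ⟨a, ha⟩ := heff.exists_model fun k X hX hi hl =>
    hc (.negE (haff hl) (.recur X hX fun i => haff (hi i)))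
  exact ⟨a, fun M hM X => by rw [ha M hM]; exact hval M hM X⟩

/-! ### The truth lemma and strong completeness for `CO`. -/

@[elab_as_elim]
theorem CO.induction {P : CO σ → Prop} (atom : ∀ X x, P (atom X x)) (neg : ∀ α, P α → P (neg α))
    (and : ∀ α β, P α → P β → P (and α β)) (or : ∀ α β, P α → P β → P (or α β))
    (cf : ∀ M hM α, P α → P (cf M hM α)) (α : CO σ) : P α := by
  suffices H : ∀ b (φ : Fml σ b), ∀ hb : b = false, P (cast (congrArg (Fml σ) hb) φ) from H _ α rfl
  clear α
  intro b φ
  induction φ with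
  | atom X x =>
    rintro rfl
    exact atom X x
  | dep Xs Y => exact fun hb => nomatch hb
  | neg α ih =>
    rintro rfl
    exact neg α (ih rfl)
  | and φ ψ ih₁ ih₂ =>
    rintro rfl
    exact and _ _ (ih₁ rfl) (ih₂ rfl)
  | or φ ψ ih₁ ih₂ =>
    rintro rfl
    exact or _ _ (ih₁ rfl) (ih₂ rfl)
  | cf M hM φ ih =>
    rintro rfl
    exact cf M hM _ (ih rfl)

/-- Both truth values and all consistent antecedents `M` are treated together, since negation swaps
the former and nested counterfactuals change the latter. -/
theorem Derives.truth {Ax Γ : Set (COD σ)} {a : Sem σ}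
    (ha : ∀ M, Consistent M → ∀ X, Derives Ax Γ (box M (atom X (a.val M X)))) (α : CO σ) :
    ∀ M, Consistent M → (GSat {a.intervene M} α → Derives Ax Γ (box M α.lift)) ∧
      (¬ GSat {a.intervene M} α → Derives Ax Γ (box M (neg α))) := by
  induction α using CO.induction with
  | atom X x =>
    intro M hM
    rw [gsat_atom_single]
    exact ⟨fun h => h ▸ ha M hM X, fun h => (ha M hM X).boxSub (.valUnq X _ _ h (.hyp rfl))⟩
  | neg α ih =>
    intro M hM
    rw [gsat_neg_single, not_not]
    exact ⟨(ih M hM).2, fun h => ((ih M hM).1 h).boxSub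
      (.negI (.negE (α := α) (.hyp (.inr rfl)) .hyp₀))⟩
  | and α β ih₁ ih₂ =>
    intro M hM
    refine ⟨fun h => .boxAndI ((ih₁ M hM).1 h.1) ((ih₂ M hM).1 h.2), fun h => ?_⟩
    rcases not_and_or.1 h with h | h
    · exact ((ih₁ M hM).2 h).boxSub (.negI (.negE (α := α) (.andE₁ .hyp₀) (.hyp (.inr rfl))))
    · exact ((ih₂ M hM).2 h).boxSub (.negI (.negE (α := β) (.andE₂ .hyp₀) (.hyp (.inr rfl))))
  | or α β ih₁ ih₂ =>
    intro M hM
    rw [gsat_or_single]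
    refine ⟨fun h => ?_, fun h => ?_⟩
    · rcases h with h | h
      · exact ((ih₁ M hM).1 h).boxSub (.orI₁ (.hyp rfl))
      · exact ((ih₂ M hM).1 h).boxSub (.orI₂ (.hyp rfl))
    · rw [not_or] at h
      refine (Derives.boxAndI ((ih₁ M hM).2 h.1) ((ih₂ M hM).2 h.2)).boxSub (.negI ?_)
      refine .orE (α := bot) (φ := α.lift) (ψ := β.lift) .hyp₀ ?_ ?_
      · exact .negE (α := α) .hyp₀ (.andE₁ (.hyp (.inr (.inr rfl))))
      · exact .negE (α := β) .hyp₀ (.andE₂ (.hyp (.inr (.inr rfl))))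
  | cf N hN β ih =>
    intro M hM
    rw [← box_of_ne hN, lift_box, gsat_box, Set.image_singleton]
    by_cases hc : Consistent N
    · have hK := consistent_removeVars_add hM hc
      rw [Sem.intervene_intervene _ hM hc, not_or, not_not]
      refine ⟨fun h => ?_, fun h => ?_⟩
      · have h := (ih _ hK).1 (h.resolve_left (not_not_intro hc))
        -- The rule `boxExp` needs disjoint variables, so the nested counterfactual is obtained by
        -- contradiction: its negation is pushed inside and the two antecedents are merged by
        -- `boxExtr`.
        have := Derives.raa (Ax := Ax) (Γ := Γ) (α := box M (box N β)) ?_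
        · rwa [lift_box, lift_box] at this
        refine Derives.box_contradiction hK h.wk (.boxExtr hM ?_)
        exact (Derives.negBoxE .hyp₀).boxSub (.negBoxE (.hyp rfl))
      · have h := (ih _ hK).2 h.2
        refine .negBoxE (.negI ?_)
        rw [lift_box, lift_box]
        exact Derives.box_contradiction hK (.boxExtr hM .hyp₀) h.wk
    · refine ⟨fun _ => .boxNec M fun _ => .box_of_not_consistent hc, fun h => ?_⟩
      exact absurd (.inl hc) h

/-- Otherwise `Δ` with `¬β` would be consistent, and the model of a deciding extension would be a
countermodel. -/
theorem derives_of_gsat {Ax : Set (COD σ)} {Δ : Set (CO σ)} {β : CO σ}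
    (h : ∀ a, (∀ α ∈ Δ, GSat {a} α) → GSat {a} β) : Derives Ax (lift '' Δ) β.lift := by
  by_contra hβ
  obtain ⟨Γ, hΓ, hd⟩ := exists_deciding (Γ := insert (neg β) (lift '' Δ)) fun h => hβ (.raa h)
  obtain ⟨a, ha⟩ := hd.exists_model
  have ht := fun α => Derives.truth ha α 0 consistent_zero
  simp only [box_zero] at ht
  refine hd.1 (.negE (α := β) ((ht β).1 (h _ fun α hα => ?_)) (.hyp (hΓ (Set.mem_insert _ _))))
  by_contra hα'
  exact hd.1 (.negE (.hyp (hΓ (.inr ⟨α, hα, rfl⟩))) ((ht α).2 hα'))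

/-! ### Realizations and completeness over generalized causal teams -/

theorem lift_eq_self (φ : COD σ) : φ.lift = φ := by
  suffices H : ∀ b (φ : Fml σ b), ∀ hb : b = true, φ.lift = cast (congrArg (Fml σ) hb) φ from
    H _ φ rfl
  clear φ
  intro b φ
  induction φ with
  | atom X x =>
    rintro rfl
    rfl
  | dep Xs Y => exact fun _ => rfl
  | neg α =>
    rintro rfl
    rfl
  | and φ ψ ih₁ ih₂ =>
    rintro rfl
    exact congrArg₂ Fml.and (ih₁ rfl) (ih₂ rfl)
  | or φ ψ ih₁ ih₂ =>
    rintro rfl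
    exact congrArg₂ Fml.or (ih₁ rfl) (ih₂ rfl)
  | cf M hM φ ih =>
    rintro rfl
    exact congrArg (Fml.cf M hM) (ih rfl)

/-- The largest team that satisfies all the formulas of `Δ`. -/
def models (Δ : Set (CO σ)) : GTeam σ := {a | ∀ α ∈ Δ, GSat {a} α}

theorem gsat_models_of_mem {Δ : Set (CO σ)} {α : CO σ} (hα : α ∈ Δ) : GSat (models Δ) α :=
  (gsat_flat α).2 fun _ ha => ha α hα

theorem derives_of_gsat_models {Ax : Set (COD σ)} {Δ : Set (CO σ)} {β : CO σ}
    (h : GSat (models Δ) β) : Derives Ax (lift '' Δ) β.lift :=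
  derives_of_gsat fun a ha => (gsat_flat β).1 h a ha

/-- Each constancy assumption is split into its values, and the chosen value is added to `Δ`. When
`Xs` is exhausted, `Y` is constant on `models Δ`, so its value is provable in `CO`. -/
theorem derives_con_of_gsat_models {Ax : Set (COD σ)} {Y : σ.Var} (Xs : List σ.Var)
    {Δ : Set (CO σ)} {Γ : Set (COD σ)} (h : GSat (models Δ) (dep Xs Y)) (hΓ : lift '' Δ ⊆ Γ)
    (hXs : ∀ X ∈ Xs, Derives Ax Γ (con X)) : Derives Ax Γ (con Y) := by
  induction Xs generalizing Δ Γ with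
  | nil =>
    obtain ⟨y, hy⟩ := exists_gsat_atom h
    exact .depI₀ ((derives_of_gsat_models (β := atom Y y) hy).weaken hΓ)
  | cons X Xs ih =>
    refine .dep₀E .hole (hXs X List.mem_cons_self) fun x => ?_
    refine ih (Δ := insert (atom X x) Δ) (fun a ha a' ha' e => ?_) ?_ fun X' hX' =>
      (hXs X' (List.mem_cons_of_mem _ hX')).wk
    · refine h a (fun α hα => ha α (.inr hα)) a' (fun α hα => ha' α (.inr hα)) fun X' hX' => ?_
      rcases List.mem_cons.1 hX' with rfl | hX'
      · exact (gsat_atom_single.1 (ha _ (.inl rfl))).trans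
          (gsat_atom_single.1 (ha' _ (.inl rfl))).symm
      · exact e X' hX'
    · rw [Set.image_insert_eq]
      exact Set.insert_subset_insert hΓ

theorem derives_dep_of_gsat_models {Ax : Set (COD σ)} {Y : σ.Var} {Xs : List σ.Var}
    {Δ : Set (CO σ)} (h : GSat (models Δ) (dep Xs Y)) : Derives Ax (lift '' Δ) (dep Xs Y) :=
  .depI (derives_con_of_gsat_models Xs h Set.subset_union_left fun X hX => .hyp (.inr ⟨X, hX, rfl⟩))

theorem Derives.fill {Ax : Set (COD σ)} {φ χ : COD σ} (h : Derives Ax {φ} χ) (C : Ctx σ) :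
    Derives Ax {C.fill φ} (C.fill χ) := by
  have wk : ∀ {φ ψ χ : COD σ}, Derives Ax {φ} ψ → Derives Ax (insert φ {χ}) ψ := fun h =>
    h.weaken (Set.singleton_subset_iff.2 (Set.mem_insert _ _))
  induction C with
  | hole => exact h
  | andL C ψ ih =>
    have h₀ : Derives Ax {Fml.and (C.fill φ) ψ} (Fml.and (C.fill φ) ψ) := .hyp rfl
    exact .andI (h₀.andE₁.trans_single ih) h₀.andE₂
  | andR ψ C ih =>
    have h₀ : Derives Ax {Fml.and ψ (C.fill φ)} (Fml.and ψ (C.fill φ)) := .hyp rfl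
    exact .andI h₀.andE₁ (h₀.andE₂.trans_single ih)
  | orL C ψ ih => exact .orSub (.hyp (Set.mem_singleton _)) (wk ih)
  | orR φ C ih => exact .orCom (.orSub (.orCom (.hyp (Set.mem_singleton _))) (wk ih))
  | cf M hM C ih =>
    have := boxSub (Γ := {box M (C.fill φ)}) (M := M) (.hyp (Set.mem_singleton _)) ih
    rwa [box_of_ne hM, box_of_ne hM] at this

/-- Composition of contexts. -/
def Ctx.comp : Ctx σ → Ctx σ → Ctx σ
  | .hole, D => D
  | .andL C ψ, D => .andL (C.comp D) ψ
  | .andR φ C, D => .andR φ (C.comp D)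
  | .orL C ψ, D => .orL (C.comp D) ψ
  | .orR φ C, D => .orR φ (C.comp D)
  | .cf M hM C, D => .cf M hM (C.comp D)

theorem Ctx.fill_comp (C D : Ctx σ) (χ : COD σ) :
    (C.comp D).fill χ = C.fill (D.fill χ) := by
  induction C <;> simp_all [Ctx.comp, Ctx.fill]

/-- The formulas in `R` are realizations of `φ`: they imply `φ`, provably and inside any context
`φ` can be replaced by them in a proof by cases, and a team satisfies `φ` only if it satisfies one
of them. -/
structure Realizes (R : Set (CO σ)) (φ : COD σ) : Prop where
  derives : ∀ α ∈ R, Derives ∅ {α.lift} φ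
  cases : ∀ (C : Ctx σ) (Γ : Set (COD σ)) (ψ : COD σ),
    (∀ α ∈ R, Derives ∅ (insert (C.fill α.lift) Γ) ψ) → Derives ∅ (insert (C.fill φ) Γ) ψ
  exists_of_gsat : ∀ T, GSat T φ → ∃ α ∈ R, GSat T α

namespace Realizes

variable {R S : Set (CO σ)} {φ χ : COD σ}

theorem of_lift (α : CO σ) : Realizes {α} α.lift where
  derives := by
    rintro _ rfl
    exact .hyp rfl
  cases C Γ ψ h := h α rfl
  exists_of_gsat T h := ⟨α, rfl, gsat_lift.1 h⟩

theorem of_con (X : σ.Var) : Realizes (Set.range fun x => atom X x) (con X) where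
  derives := by
    rintro _ ⟨x, rfl⟩
    exact .depI₀ (.hyp (Set.mem_singleton _))
  cases C Γ ψ h := .dep₀E C .hyp₀ fun x =>
    (h _ ⟨x, rfl⟩).weaken (Set.insert_subset_insert (Set.subset_insert _ _))
  exists_of_gsat T h := (exists_gsat_atom h).elim fun x hx => ⟨_, ⟨x, rfl⟩, hx⟩

theorem and (hφ : Realizes R φ) (hχ : Realizes S χ) :
    Realizes (Set.image2 Fml.and R S) (Fml.and φ χ) where
  derives := by
    rintro _ ⟨α, hα, β, hβ, rfl⟩
    have h₀ : Derives ∅ {Fml.and α.lift β.lift} (Fml.and α.lift β.lift) := .hyp rfl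
    exact .andI (h₀.andE₁.trans_single (hφ.derives α hα)) (h₀.andE₂.trans_single (hχ.derives β hβ))
  cases C Γ ψ h := by
    -- The other conjunct becomes part of the context, which is why `cases` is required for all
    -- contexts.
    have := hφ.cases (C.comp (.andL .hole χ)) Γ ψ fun α hα => ?_
    · rwa [Ctx.fill_comp] at this
    have := hχ.cases (C.comp (.andR α.lift .hole)) Γ ψ fun β hβ => ?_
    · rwa [Ctx.fill_comp] at this ⊢
    rw [Ctx.fill_comp]
    exact h _ ⟨α, hα, β, hβ, rfl⟩
  exists_of_gsat T h := by
    obtain ⟨α, hα, h₁⟩ := hφ.exists_of_gsat T h.1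
    obtain ⟨β, hβ, h₂⟩ := hχ.exists_of_gsat T h.2
    exact ⟨_, ⟨α, hα, β, hβ, rfl⟩, h₁, h₂⟩

theorem or (hφ : Realizes R φ) (hχ : Realizes S χ) :
    Realizes (Set.image2 Fml.or R S) (Fml.or φ χ) where
  derives := by
    rintro _ ⟨α, hα, β, hβ, rfl⟩
    have h₁ := (hφ.derives α hα).fill (.orL .hole β.lift)
    have h₂ := (hχ.derives β hβ).fill (.orR φ .hole)
    exact h₁.trans_single h₂
  cases C Γ ψ h := by
    have := hφ.cases (C.comp (.orL .hole χ)) Γ ψ fun α hα => ?_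
    · rwa [Ctx.fill_comp] at this
    have := hχ.cases (C.comp (.orR α.lift .hole)) Γ ψ fun β hβ => ?_
    · rwa [Ctx.fill_comp] at this ⊢
    rw [Ctx.fill_comp]
    exact h _ ⟨α, hα, β, hβ, rfl⟩
  exists_of_gsat T h := by
    obtain ⟨T₁, T₂, s₁, s₂, e, h₁, h₂⟩ := h
    obtain ⟨α, hα, h₁⟩ := hφ.exists_of_gsat T₁ h₁
    obtain ⟨β, hβ, h₂⟩ := hχ.exists_of_gsat T₂ h₂
    exact ⟨_, ⟨α, hα, β, hβ, rfl⟩, T₁, T₂, s₁, s₂, e, h₁, h₂⟩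

theorem cf (hφ : Realizes R φ) (M : Multiset (Eqn σ)) (hM : M ≠ 0) :
    Realizes (Fml.cf M hM '' R) (Fml.cf M hM φ) where
  derives := by
    rintro _ ⟨α, hα, rfl⟩
    exact (hφ.derives α hα).fill (.cf M hM .hole)
  cases C Γ ψ h := by
    have := hφ.cases (C.comp (.cf M hM .hole)) Γ ψ fun α hα => ?_
    · rwa [Ctx.fill_comp] at this
    rw [Ctx.fill_comp]
    exact h _ ⟨α, hα, rfl⟩
  exists_of_gsat T h := by
    by_cases hc : Consistent M
    · obtain ⟨α, hα, h⟩ := hφ.exists_of_gsat _ (h.resolve_left (not_not_intro hc))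
      exact ⟨_, ⟨α, hα, rfl⟩, .inr h⟩
    -- Any realization will do here; the empty team shows that there is one.
    · obtain ⟨α, hα, -⟩ := hφ.exists_of_gsat ∅ (gsat_empty φ)
      exact ⟨_, ⟨α, hα, rfl⟩, .inl hc⟩

theorem exists_orList {l : List (COD σ)} (h : ∀ φ ∈ l, ∃ R, Realizes R φ) :
    ∃ R, Realizes R (orList l) := by
  induction l with
  | nil => exact ⟨_, of_lift bot⟩
  | cons φ l ih =>
    cases l with
    | nil => exact h φ List.mem_cons_self
    | cons ψ l =>
      obtain ⟨R, hR⟩ := h φ List.mem_cons_self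
      obtain ⟨S, hS⟩ := ih fun χ hχ => h χ (List.mem_cons_of_mem _ hχ)
      exact ⟨_, hR.or hS⟩

/-- A derivation of `φ` from `χ` itself is not required, only one from each realization. -/
theorem transfer (hχ : Realizes R χ) (h : Derives ∅ {φ} χ)
    (h' : ∀ α ∈ R, Derives ∅ {α.lift} φ) : Realizes R φ where
  derives := h'
  cases C Γ ψ hψ := by
    refine .cut ?_ (hχ.cases C Γ ψ hψ)
    rintro ξ (rfl | hξ)
    · exact (h.fill C).weaken (Set.singleton_subset_iff.2 (Set.mem_insert _ _))
    · exact .hyp (.inr hξ)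
  exists_of_gsat T hT := hχ.exists_of_gsat T (GDerives.sound h T (by rintro _ rfl; exact hT))

end Realizes

theorem derives_orList_map {Ax Γ : Set (COD σ)} {ι : Type*} {f g : ι → COD σ}
    (hfg : ∀ i, Derives Ax (insert (f i) Γ) (g i)) {l : List ι}
    (h : Derives Ax Γ (orList (l.map f))) : Derives Ax Γ (orList (l.map g)) := by
  induction l generalizing Γ with
  | nil => exact h
  | cons i l ih =>
    cases l with
    | nil => exact h.trans (hfg i)
    | cons j l =>
      refine .orCom (.orSub (.orCom (.orSub h (hfg i))) ?_)
      refine ih (fun i => (hfg i).weaken (Set.insert_subset_insert (Set.subset_insert _ _))) .hyp₀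

/-- Dependence on `X :: Xs` means dependence on `Xs` within each block `X = x`. This disjunction
follows from the atom by `valDef` and substitution. The converse is proved from each realization by
completeness for `CO`, as `orE` allows only `CO` conclusions. -/
theorem exists_realizes_dep (Xs : List σ.Var) (Y : σ.Var) : ∃ R, Realizes R (dep Xs Y) := by
  induction Xs with
  | nil => exact ⟨_, .of_con Y⟩
  | cons X Xs ih =>
    obtain ⟨S, hS⟩ := ih
    let δ : COD σ := bigOr fun x : σ.Ran X => Fml.and (atom X x) (dep Xs Y)
    obtain ⟨R, hR⟩ : ∃ R, Realizes R δ := by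
      refine Realizes.exists_orList fun φ hφ => ?_
      obtain ⟨x, -, rfl⟩ := List.mem_map.1 hφ
      exact ⟨_, (Realizes.of_lift (atom X x)).and hS⟩
    refine ⟨R, hR.transfer (derives_orList_map (fun x => ?_) (.valDef X)) fun α hα => ?_⟩
    · refine .andI .hyp₀ (.depI (.depE (Xs := X :: Xs) (.hyp (.inl (.inr rfl))) fun X' hX' => ?_))
      rcases List.mem_cons.1 hX' with rfl | hX'
      · exact .depI₀ (.hyp (.inl (.inl rfl)))
      · exact .hyp (.inr ⟨X', hX', rfl⟩)
    · have hα' : GSat (models {α}) δ := GDerives.sound (hR.derives α hα) _ (by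
        rintro _ rfl
        exact gsat_lift.2 (gsat_models_of_mem rfl))
      rw [← Set.image_singleton]
      refine derives_dep_of_gsat_models fun a ha a' ha' e => ?_
      obtain ⟨T, hT, hc⟩ := exists_cover_of_gsat_bigOr hα'
      obtain ⟨x, hx⟩ := hc a ha
      obtain ⟨x', hx'⟩ := hc a' ha'
      obtain rfl : x = x' := by
        rw [← (hT x).1 a hx, ← (hT x').1 a' hx']
        exact e X List.mem_cons_self
      exact (hT x).2 a hx a' hx' fun X' hX' => e X' (List.mem_cons_of_mem _ hX')

theorem exists_realizes (φ : COD σ) : ∃ R, Realizes R φ := by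
  suffices H : ∀ b (φ : Fml σ b), ∃ R, Realizes R φ.lift from lift_eq_self φ ▸ H _ φ
  clear φ
  intro b φ
  induction φ with
  | atom X x => exact ⟨_, .of_lift (atom X x)⟩
  | dep Xs Y => exact exists_realizes_dep Xs Y
  | neg α => exact ⟨_, .of_lift (neg α)⟩
  | and φ ψ ih₁ ih₂ =>
    obtain ⟨R, hR⟩ := ih₁
    obtain ⟨S, hS⟩ := ih₂
    exact ⟨_, hR.and hS⟩
  | or φ ψ ih₁ ih₂ =>
    obtain ⟨R, hR⟩ := ih₁
    obtain ⟨S, hS⟩ := ih₂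
    exact ⟨_, hR.or hS⟩
  | cf M hM φ ih =>
    obtain ⟨R, hR⟩ := ih
    exact ⟨_, hR.cf M hM⟩

theorem GDerives.complete {Γ : Set (COD σ)} {ψ : COD σ} (h : GEntails Γ ψ) : GDerives Γ ψ := by
  -- Compactness by finiteness: there are finitely many teams, so one premise refuting each
  -- counter-team gives a finite conjunction that still entails `ψ`.
  have hf : ∀ T : {T : GTeam σ // ¬ GSat T ψ}, ∃ φ ∈ Γ, ¬ GSat T.1 φ := by
    rintro ⟨T, hT⟩
    by_contra! hn
    exact hT (h T hn)
  choose f hfΓ hf using hf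
  let φ := andList ((enum _).map f)
  have hφ : ∀ T, GSat T φ → GSat T ψ := by
    intro T hT
    by_contra hn
    exact hf ⟨T, hn⟩ (gsat_andList.1 hT _ (List.mem_map_of_mem (mem_enum _)))
  have hΓφ : Derives ∅ Γ φ := by
    refine Derives.andList_intro fun χ hχ => ?_
    obtain ⟨T, -, rfl⟩ := List.mem_map.1 hχ
    exact .hyp (hfΓ T)
  obtain ⟨R, hR⟩ := exists_realizes φ
  obtain ⟨S, hS⟩ := exists_realizes ψ
  refine hΓφ.trans (hR.cases .hole Γ ψ fun α hα => ?_)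
  have hα' : GSat (models {α}) φ := GDerives.sound (hR.derives α hα) _ (by
    rintro _ rfl
    exact gsat_lift.2 (gsat_models_of_mem rfl))
  obtain ⟨β, hβ, hβ'⟩ := hS.exists_of_gsat _ (hφ _ hα')
  have := derives_of_gsat_models (Ax := ∅) hβ'
  rw [Set.image_singleton] at this
  exact Derives.trans_single .hyp₀ (this.trans_single (hS.derives β hβ))

/-! ### The formulas of the axioms -/

namespace Sem

theorem notMem_eqns_others {V : σ.Var} (w : Tuple (others V)) :
    ¬ ∃ x : σ.Ran V, (⟨V, x⟩ : Eqn σ) ∈ eqns (others V) w := by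
  rintro ⟨x, hx⟩
  exact (mem_eqns.1 hx).1 rfl

theorem response_of_some (a : Sem σ) {V : σ.Var} {m : Law V} (hm : a.1.2 V = some m)
    (w : Assign σ) : response a.val V w = m.2 fun X => w X := by
  unfold response
  rw [a.val_some (notMem_eqns_others _) hm]
  refine congrArg m.2 (funext fun X => ?_)
  have hX : X.1 ≠ V := fun e => m.1.2 (Eq.subst (motive := fun Y => Y ∈ m.1.1) e X.2)
  exact a.val_mem (consistent_eqns _ _) (mem_eqns.2 ⟨hX, rfl⟩)

theorem response_of_none (a : Sem σ) {V : σ.Var} (hV : a.1.2 V = none) (w : Assign σ) :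
    response a.val V w = a.1.1 V :=
  a.val_none (notMem_eqns_others _) hV

theorem response_self (a : Sem σ) (V : σ.Var) : response a.val V a.1.1 = a.1.1 V := by
  rcases hm : a.1.2 V with _ | m
  · exact a.response_of_none hm _
  · rw [a.response_of_some hm, ← a.2.2 V m hm]

/-- Responses do not see dummy arguments, so they are the invariant through which the axioms are
read. -/
theorem nonConst_iff (a : Sem σ) {V : σ.Var} :
    a.1.2.NonConst V ↔ ∃ w w', response a.val V w ≠ response a.val V w' := by
  constructor
  · rintro ⟨m, hm, hc⟩
    by_contra! h
    refine hc ⟨response a.val V a.1.1, fun p => ?_⟩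
    rw [h _ p.extend, a.response_of_some hm, p.extend_restrict]
  · rintro ⟨w, w', hne⟩
    rcases hm : a.1.2 V with _ | m
    · rw [a.response_of_none hm, a.response_of_none hm] at hne
      exact absurd rfl hne
    · refine ⟨m, hm, fun ⟨c, hc⟩ => hne ?_⟩
      rw [a.response_of_some hm, a.response_of_some hm, hc, hc]

theorem response_of_not_nonConst (a : Sem σ) {V : σ.Var} (h : ¬ a.1.2.NonConst V) (w : Assign σ) :
    response a.val V w = a.1.1 V := by
  rw [nonConst_iff] at h
  push Not at h
  rw [h w a.1.1, response_self]

theorem sim_of_response {a b : Sem σ} (h : ∀ V, a.1.2.NonConst V ↔ b.1.2.NonConst V)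
    (h' : ∀ V, a.1.2.NonConst V → ∀ w, response a.val V w = response b.val V w) :
    a.1.2.Sim b.1.2 := by
  classical
  refine ⟨h, fun V m n hV hm hn p q hpq => ?_⟩
  -- An assignment extending `p` and `q` at once, which exists because they agree on common parents.
  let w : Assign σ := fun X => if hX : X ∈ m.1.1 then p ⟨X, hX⟩ else
    if hX' : X ∈ n.1.1 then q ⟨X, hX'⟩ else Classical.arbitrary _
  have := h' V hV w
  rw [a.response_of_some hm, b.response_of_some hn] at this
  convert this using 2
  · funext X
    simp [w]
  · funext X
    by_cases hX : X.1 ∈ m.1.1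
    · simp [w, hX, hpq X hX X.2]
    · simp [w, hX]

/-- Two causal models with the same responses have the same assignments
after each intervention. -/
theorem val_eq_of_response {a b : Sem σ}
    (h : ∀ V w, response a.val V w = response b.val V w) {M : Multiset (Eqn σ)}
    (hM : Consistent M) : a.val M = b.val M := by
  have hb : ∀ V, (¬ ∃ x : σ.Ran V, (⟨V, x⟩ : Eqn σ) ∈ M) →
      b.val M V = response b.val V (b.val M) := by
    intro V hV
    rcases hm : b.1.2 V with _ | m
    · rw [b.val_none hV hm, b.response_of_none hm]
    · rw [b.val_some hV hm, b.response_of_some hm]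
  refine Sys.doAssign_unique a.2.1 hM (fun V x hx => b.val_mem hM hx) (fun V hV hn => ?_)
    fun V m hV hm => ?_
  · rw [hb V hV, ← h, a.response_of_none hn]
  · rw [hb V hV, ← h, a.response_of_some hm]

end Sem

theorem gsat_box_eqns_others {V : σ.Var} {a : Sem σ} {w : Assign σ} {v : σ.Ran V} :
    GSat {a} (box (eqns (others V) fun X => w X) (atom V v) : CO σ) ↔
      response a.val V w = v :=
  gsat_box_atom_single (consistent_eqns _ _)

open Classical in
theorem gsat_box_eqns_add {X V : σ.Var} (hXV : X ≠ V) {a : Sem σ} {w : Assign σ} {x : σ.Ran X}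
    {v : σ.Ran V} : GSat {a} (box (eqns ({X, V}ᶜ : Set σ.Var) (fun Y => w Y) + {⟨X, x⟩})
      (atom V v) : CO σ) ↔ response a.val V (Function.update w X x) = v := by
  rw [← gsat_box_congr (mem_eqns_update hXV w x)]
  exact gsat_box_eqns_others

theorem gsat_and {b : Bool} {φ ψ : Fml σ b} {T : GTeam σ} :
    GSat T (and φ ψ) ↔ GSat T φ ∧ GSat T ψ := Iff.rfl

/-- By `response_congr` a variable without parents has a constant response; a parent with its
witnesses is exactly a disjunct of `betaEn V`. -/
theorem gsat_betaEn {a : Sem σ} {V : σ.Var} : GSat {a} (betaEn V) ↔ a.1.2.NonConst V := by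
  classical
  unfold betaEn betaDC
  rw [gsat_bigOr_single, Sem.nonConst_iff]
  simp only [gsat_bigOr_single]
  constructor
  · rintro ⟨⟨X, hX⟩, ⟨⟨z, ⟨x, x'⟩, v, v'⟩, hx, hv⟩, h₁, h₂⟩
    rw [← Tuple.extend_restrict z, gsat_box_eqns_add hX] at h₁ h₂
    exact ⟨_, _, fun e => hv (h₁.symm.trans (e.trans h₂))⟩
  · rintro ⟨w, w', hne⟩
    obtain ⟨X, hXV, w, x, hne⟩ : ∃ X, X ∈ parents a.val V := by
      by_contra! h
      exact hne (response_congr a.val V fun X hX => absurd hX (h X))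
    refine ⟨⟨X, hXV⟩, ⟨⟨fun Y => w Y, (w X, x), (_, _)⟩, fun e => ?_, hne⟩, gsat_and.2 ⟨?_, ?_⟩⟩
    · have e : w X = x := e
      rw [← e, Function.update_eq_self] at hne
      exact hne rfl
    · exact (gsat_box_eqns_add hXV).2
        (congrArg (response a.val V) (Function.update_eq_self X w))
    · exact (gsat_box_eqns_add hXV).2 rfl

theorem gsat_allCon {T : GTeam σ} {V : σ.Var} : GSat T (allCon V) ↔
    ∀ a ∈ T, ∀ b ∈ T, ∀ w, response a.val V w = response b.val V w := by
  unfold allCon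
  simp only [gsat_bigAnd, gsat_box_of_consistent (consistent_eqns _ _), gsat_con,
    Set.forall_mem_image]
  constructor
  · exact fun h a ha b hb w => h (fun X => w X) ha hb
  · intro h w a ha b hb
    have := h a ha b hb w.extend
    unfold response at this
    rwa [Tuple.extend_restrict] at this

theorem gsat_chiOne {T : GTeam σ} : GSat T (chiOne σ) ↔ ∀ a ∈ T, ∀ b ∈ T, a.1.1 = b.1.1 ∧
    ∀ V w, response a.val V w = response b.val V w := by
  unfold chiOne
  rw [gsat_bigAnd]
  constructor
  · exact fun h a ha b hb => ⟨funext fun V => gsat_con.1 (h V).1 a ha b hb,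
      fun V => gsat_allCon.1 (h V).2 a ha b hb⟩
  · exact fun h V => ⟨gsat_con.2 fun a ha b hb => congrFun (h a ha b hb).1 V,
      gsat_allCon.2 fun a ha b hb => (h a ha b hb).2 V⟩

theorem gsat_eta {a : Sem σ} {V : σ.Var} {m : Law V} :
    GSat {a} (eta V m) ↔ ∀ w, response a.val V w = m.2 fun X => w X := by
  have key : ∀ (w : Assign σ) (p : Eqn σ), p ∈ eqns (others V) (fun X => w X) ↔
      p ∈ eqns ((m.1.1 ∪ {V})ᶜ : Set σ.Var) (fun X => w X) + eqns m.1.1 (fun X => w X) := by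
    intro w p
    rw [Multiset.mem_add, mem_eqns, mem_eqns, mem_eqns]
    constructor
    · rintro ⟨h, e⟩
      by_cases hp : p.1 ∈ m.1.1
      · exact .inr ⟨hp, e⟩
      · exact .inl ⟨fun h' => h'.elim hp h, e⟩
    · rintro (⟨h, e⟩ | ⟨h, e⟩)
      · exact ⟨fun h' => h (.inr h'), e⟩
      · exact ⟨fun h' => m.1.2 (h' ▸ h), e⟩
  unfold eta
  rw [gsat_bigAnd]
  constructor
  · intro h w
    rw [← gsat_box_eqns_others, gsat_box_congr (key w)]
    exact h (fun X => w X, fun X => w X)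
  · classical
    rintro h ⟨w, p⟩
    let u : Assign σ := fun X => if hX : X ∈ m.1.1 then p ⟨X, hX⟩ else w.extend X
    have h₁ : (fun X : m.1.1 => u X) = p := by
      funext X
      simp [u]
    have h₂ : (fun X : ((m.1.1 ∪ {V})ᶜ : Set σ.Var) => u X) = w := by
      funext X
      have hX : X.1 ∉ m.1.1 := fun hX => X.2 (.inl hX)
      simpa [u, hX] using w.extend_apply X
    have := gsat_box_eqns_others.2 (h u)
    rwa [gsat_box_congr (key u), h₁, h₂] at this

theorem gsat_xi {a : Sem σ} {V : σ.Var} :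
    GSat {a} (xi V) ↔ ∀ w, response a.val V w = a.1.1 V := by
  unfold xi sel
  simp only [gsat_bigAnd, gsat_or_single, gsat_neg_single, gsat_atom_single, Prod.forall]
  constructor
  · intro h w
    exact gsat_box_eqns_others.1 ((h (a.1.1 V) fun X => w X).resolve_left (not_not_intro rfl))
  · intro h v w
    rw [or_iff_not_imp_left, not_not]
    rintro rfl
    have := gsat_box_eqns_others.2 (h w.extend)
    rwa [Tuple.extend_restrict] at this

theorem gsat_describe {a c : Sem σ} : GSat {a} (describe c) ↔ (∀ V, a.1.1 V = c.1.1 V) ∧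
    (∀ V m, c.1.2 V = some m → ∀ w, response a.val V w = m.2 fun X => w X) ∧
    ∀ V, ¬ c.1.2.NonConst V → ∀ w, response a.val V w = a.1.1 V := by
  unfold describe Phi
  refine and_congr ?_ (and_congr ?_ ?_)
  · simp only [gsat_bigAnd, gsat_atom_single]
  · simp only [gsat_bigAnd, gsat_eta, Subtype.forall, Sigma.forall]
  · simp only [gsat_bigAnd, gsat_xi, Subtype.forall]

theorem gsat_describe_self (a : Sem σ) : GSat {a} (describe a) :=
  gsat_describe.2 ⟨fun _ => rfl, fun _ _ => a.response_of_some,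
    fun _ => a.response_of_not_nonConst⟩

theorem equiv_of_gsat_describe {a c : Sem σ} (h : GSat {a} (describe c)) : c.Equiv a := by
  obtain ⟨h₁, h₂, h₃⟩ := gsat_describe.1 h
  have h₄ : ∀ V, c.1.2.NonConst V → ∀ w, response c.val V w = response a.val V w := by
    rintro V ⟨m, hm, -⟩ w
    rw [h₂ V m hm, c.response_of_some hm]
  refine ⟨funext fun V => (h₁ V).symm, Sem.sim_of_response (fun V => ?_) h₄⟩
  by_cases hV : c.1.2.NonConst V
  · refine iff_of_true hV ?_
    have h := hV
    rw [Sem.nonConst_iff] at h ⊢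
    simpa only [h₄ V hV] using h
  · refine iff_of_false hV ?_
    rw [Sem.nonConst_iff]
    rintro ⟨w, w', hne⟩
    rw [h₃ V hV, h₃ V hV] at hne
    exact hne rfl

theorem gsat_theta {T S : GTeam σ} : GSat T (Theta S) ↔ ∀ a ∈ T, ∃ c ∈ S, GSat {a} (describe c) := by
  unfold Theta
  rw [gsat_flat]
  simp only [gsat_bigOr_single, Subtype.exists, exists_prop]

/-! ### Causal teams as uniform generalized causal teams -/

/-- All the members of `T` have the same system of functions. -/
def Uniform (T : GTeam σ) : Prop := ∀ a ∈ T, ∀ b ∈ T, a.1.2 = b.1.2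

theorem gsat_oneFun_of_uniform {T : GTeam σ} (hT : Uniform T) : GSat T (oneFun σ) := by
  unfold oneFun sel
  rw [gsat_bigAnd]
  intro V
  by_cases hV : ∃ a ∈ T, a.1.2.NonConst V
  · obtain ⟨c, hc, m, hm, -⟩ := hV
    refine gsat_or_right (gsat_allCon.2 fun a ha b hb w => ?_)
    rw [a.response_of_some (hT a ha c hc ▸ hm), b.response_of_some (hT b hb c hc ▸ hm)]
  · refine gsat_or_left fun a ha h => hV ⟨a, ha, gsat_betaEn.1 h⟩

theorem gsat_noMix_of_uniform {T : GTeam σ} (hT : Uniform T) : GSat T (noMix σ) := by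
  unfold noMix XiStar
  simp only [gsat_bigAnd]
  rintro V ⟨⟨a, b⟩, ha, hb⟩
  rw [gsat_betaEn] at ha hb
  -- The first part has at most one element: `a` and `b` disagree on whether `V` is non-constant, so
  -- a single system cannot be equivalent to both, and then the assignment is determined as well.
  refine gsat_or_iff.2 ⟨{c ∈ T | c.Equiv a ∨ c.Equiv b}, {c ∈ T | ¬ (c.Equiv a ∨ c.Equiv b)},
    fun c hc => ?_, gsat_chiOne.2 ?_, gsat_lift.2 (gsat_theta.2 ?_)⟩
  · by_cases h : c.Equiv a ∨ c.Equiv b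
    · exact .inl ⟨hc, h⟩
    · exact .inr ⟨hc, h⟩
  · rintro c ⟨hc, hc'⟩ d ⟨hd, hd'⟩
    have e := hT c hc d hd
    suffices h : c = d by
      subst h
      exact ⟨rfl, fun _ _ => rfl⟩
    refine Subtype.ext (Prod.ext ?_ e)
    have key : ∀ {c d : Sem σ}, c.1.2 = d.1.2 → c.Equiv a → ¬ d.Equiv b := fun e h h' =>
      hb ((h'.2.1 V).1 (e ▸ (h.2.1 V).2 ha))
    rcases hc' with hc' | hc' <;> rcases hd' with hd' | hd'
    · exact hc'.1.trans hd'.1.symm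
    · exact absurd hd' (key e hc')
    · exact absurd hc' (key e.symm hd')
    · exact hc'.1.trans hd'.1.symm
  · rintro c ⟨_, hc⟩
    exact ⟨c, not_or.1 hc, gsat_describe_self c⟩

/-- Generalized causal teams that satisfy the two axioms cannot be distinguished from uniform
ones. -/
theorem exists_uniform {T : GTeam σ} (h₁ : GSat T (oneFun σ)) (h₂ : GSat T (noMix σ)) :
    ∃ U, Uniform U ∧ ∀ φ : COD σ, GSat T φ ↔ GSat U φ := by
  classical
  -- In `XiStar a b` neither `a` nor `b` can lie in the part satisfying `Theta`. Both then satisfy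
  -- `chiOne`, which makes their responses equal.
  have hmix : ∀ a ∈ T, ∀ b ∈ T, ∀ V, a.1.2.NonConst V → b.1.2.NonConst V := by
    intro a ha b hb V hVa
    by_contra hVb
    unfold noMix XiStar at h₂
    simp only [gsat_bigAnd] at h₂
    obtain ⟨T₁, T₂, -, -, e, h₁, h₂⟩ := h₂ V ⟨(a, b), gsat_betaEn.2 hVa, mt gsat_betaEn.1 hVb⟩
    rw [gsat_lift, gsat_theta] at h₂
    have ha₁ : a ∈ T₁ := (e ▸ ha : a ∈ T₁ ∪ T₂).resolve_right fun h => by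
      obtain ⟨c, hc, hc'⟩ := h₂ a h
      exact hc.1 (equiv_of_gsat_describe hc')
    have hb₁ : b ∈ T₁ := (e ▸ hb : b ∈ T₁ ∪ T₂).resolve_right fun h => by
      obtain ⟨c, hc, hc'⟩ := h₂ b h
      exact hc.2 (equiv_of_gsat_describe hc')
    rw [Sem.nonConst_iff] at hVa hVb
    have := (gsat_chiOne.1 h₁ a ha₁ b hb₁).2 V
    simp only [this] at hVa
    exact hVb hVa
  -- By `hmix` no member falls under the negated disjunct of `1Fun`, so `allCon V` holds for all of
  -- them together.
  have hfun : ∀ a ∈ T, ∀ b ∈ T, ∀ V, a.1.2.NonConst V → ∀ w,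
      response a.val V w = response b.val V w := by
    intro a ha b hb V hVa
    unfold oneFun sel at h₁
    rw [gsat_bigAnd] at h₁
    obtain ⟨T₁, T₂, -, -, e, h₁, h₂⟩ := h₁ V
    have ha₂ : a ∈ T₂ := (e ▸ ha : a ∈ T₁ ∪ T₂).resolve_left fun h =>
      h₁ a h (gsat_betaEn.2 hVa)
    have hb₂ : b ∈ T₂ := (e ▸ hb : b ∈ T₁ ∪ T₂).resolve_left fun h =>
      h₁ b h (gsat_betaEn.2 (hmix a ha b hb V hVa))
    exact gsat_allCon.1 h₂ a ha₂ b hb₂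
  rcases T.eq_empty_or_nonempty with rfl | ⟨c, hc⟩
  · exact ⟨∅, fun a ha => ha.elim, fun φ => Iff.rfl⟩
  -- Variables with constant law become exogenous: members may disagree on their constants, and
  -- these are still recorded in the assignments.
  let F : Sys σ := fun V => if c.1.2.NonConst V then c.1.2 V else none
  have hF : ∀ {V m}, F V = some m → c.1.2.NonConst V ∧ c.1.2 V = some m := by
    intro V m hm
    simp only [F] at hm
    split_ifs at hm with h
    exact ⟨h, hm⟩
  have hrec : F.Recursive := by
    intro X hX
    refine c.2.1 X (Relation.TransGen.mono ?_ X X hX)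
    rintro A B ⟨m, hm, hA⟩
    exact ⟨m, (hF hm).2, hA⟩
  have hcomp : ∀ a ∈ T, F.Compatible a.1.1 := by
    intro a ha V m hm
    rw [← a.response_self, ← hfun c hc a ha V (hF hm).1, c.response_of_some (hF hm).2]
  let f : Sem σ → Sem σ := fun a => if h : a ∈ T then ⟨(a.1.1, F), hrec, hcomp a h⟩ else a
  have hf₁ : ∀ a ∈ T, (f a).1.1 = a.1.1 := by
    intro a ha
    simp only [f, dif_pos ha]
  have hf₂ : ∀ a ∈ T, (f a).1.2 = F := by
    intro a ha
    simp only [f, dif_pos ha]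
  have hres : ∀ a ∈ T, ∀ V w, response a.val V w = response (f a).val V w := by
    intro a ha V w
    by_cases hV : c.1.2.NonConst V
    · rw [← hfun c hc a ha V hV]
      obtain ⟨m, hm, -⟩ := id hV
      rw [c.response_of_some hm, (f a).response_of_some]
      rw [hf₂ a ha]
      exact (if_pos hV).trans hm
    · rw [a.response_of_not_nonConst fun h => hV (hmix a ha c hc V h), (f a).response_of_none,
        hf₁ a ha]
      rw [hf₂ a ha]
      exact if_neg hV
  refine ⟨f '' T, ?_, fun φ => ?_⟩
  · rintro _ ⟨a, ha, rfl⟩ _ ⟨b, hb, rfl⟩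
    rw [hf₂ a ha, hf₂ b hb]
  -- This relation is preserved under interventions, so it transfers satisfaction of all formulas.
  let P : Sem σ → Sem σ → Prop := fun a b => ∀ M, Consistent M → a.val M = b.val M
  have hP : ∀ a ∈ T, P a (f a) := fun a ha M hM =>
    Sem.val_eq_of_response (hres a ha) hM
  have hsymm : ∀ a b, P a b → P b a := fun a b h M hM => (h M hM).symm
  have hassign : ∀ a b, P a b → a.1.1 = b.1.1 := by
    intro a b h
    simpa only [Sem.val, Sem.intervene_zero] using h 0 consistent_zero
  have hint : ∀ a b M, Consistent M → P a b → P (a.intervene M) (b.intervene M) := by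
    intro a b M hM h N hN
    simpa only [Sem.val, Sem.intervene_intervene _ hM hN] using
      h _ (consistent_removeVars_add hM hN)
  constructor
  · intro h
    exact gsat_image_congr hsymm hassign (.inr hint) hP (g := id) (by rwa [Set.image_id])
  · intro h
    have := gsat_image_congr hsymm hassign (.inr hint) (fun a ha => hsymm _ _ (hP a ha)) h
    rwa [Set.image_id'] at this

namespace CausalTeam

/-- The generalized causal team that corresponds to a causal team. -/
def toGTeam (T : CausalTeam σ) : GTeam σ := {a | a.1.1 ∈ T.team ∧ a.1.2 = T.fn}

theorem uniform_toGTeam (T : CausalTeam σ) : Uniform T.toGTeam :=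
  fun _ ha _ hb => ha.2.trans hb.2.symm

/-- The member of the generalized causal team with the assignment `s`. -/
def model (T : CausalTeam σ) {s : Assign σ} (hs : s ∈ T.team) : Sem σ :=
  ⟨(s, T.fn), T.recursive, T.compat s hs⟩

theorem model_mem (T : CausalTeam σ) {s : Assign σ} (hs : s ∈ T.team) :
    T.model hs ∈ T.toGTeam := ⟨hs, rfl⟩

theorem eq_model {T : CausalTeam σ} {a : Sem σ} (ha : a ∈ T.toGTeam) : a = T.model ha.1 :=
  Subtype.ext (Prod.ext rfl ha.2)

theorem toGTeam_single (T : CausalTeam σ) {s : Assign σ} (hs : s ∈ T.team) :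
    (T.single s hs).toGTeam = {T.model hs} := by
  ext a
  constructor
  · rintro ⟨h, h'⟩
    exact Subtype.ext (Prod.ext h h')
  · rintro rfl
    exact ⟨rfl, rfl⟩

theorem toGTeam_intervene (T : CausalTeam σ) (M : Multiset (Eqn σ)) :
    (T.intervene M).toGTeam = Sem.intervene M '' T.toGTeam := by
  ext a
  constructor
  · rintro ⟨⟨s, hs, e⟩, h⟩
    exact ⟨T.model hs, T.model_mem hs, Subtype.ext (Prod.ext e h.symm)⟩
  · rintro ⟨b, hb, rfl⟩
    rw [eq_model hb]
    exact ⟨⟨_, hb.1, rfl⟩, rfl⟩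

theorem sat_iff {b : Bool} {φ : Fml σ b} {T : CausalTeam σ} : T.Sat φ ↔ GSat T.toGTeam φ := by
  induction φ generalizing T with
  | atom X x => exact ⟨fun h a ha => h _ ha.1, fun h s hs => h _ (T.model_mem hs)⟩
  | dep Xs Y =>
    exact ⟨fun h a ha a' ha' => h _ ha.1 _ ha'.1,
      fun h s hs s' hs' => h _ (T.model_mem hs) _ (T.model_mem hs')⟩
  | neg α ih =>
    constructor
    · intro h a ha hα
      rw [eq_model ha, ← toGTeam_single, ← ih] at hα
      exact h _ _ hα
    · intro h s hs hα
      rw [ih, toGTeam_single] at hα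
      exact h _ (T.model_mem hs) hα
  | and φ ψ ih₁ ih₂ => exact and_congr ih₁ ih₂
  | or φ ψ ih₁ ih₂ =>
    rw [gsat_or_iff]
    constructor
    · rintro ⟨T₁, T₂, s₁, s₂, e, h₁, h₂⟩
      refine ⟨_, _, fun a ha => ?_, ih₁.1 h₁, ih₂.1 h₂⟩
      have : a.1.1 ∈ T₁.team ∪ T₂.team := e ▸ ha.1
      exact this.imp (fun h => ⟨h, ha.2.trans s₁.2.symm⟩) (fun h => ⟨h, ha.2.trans s₂.2.symm⟩)
    · rintro ⟨S₁, S₂, e, h₁, h₂⟩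
      -- The causal subteam of `T` carved out by `S`; members of `S` with another system of
      -- functions are dropped.
      let R : GTeam σ → CausalTeam σ := fun S =>
        ⟨{s | ∃ hs : s ∈ T.team, T.model hs ∈ S}, T.fn, T.recursive, fun s hs => T.compat s hs.1⟩
      have hR : ∀ S, (R S).toGTeam ⊆ S := by
        rintro S a ⟨⟨hs, h⟩, e⟩
        have : a = T.model hs := Subtype.ext (Prod.ext rfl e)
        rwa [this]
      refine ⟨R S₁, R S₂, ⟨fun s hs => hs.1, rfl⟩, ⟨fun s hs => hs.1, rfl⟩, ?_,
        ih₁.2 (gsat_mono (hR _) h₁), ih₂.2 (gsat_mono (hR _) h₂)⟩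
      refine Set.Subset.antisymm (Set.union_subset (fun s hs => hs.1) fun s hs => hs.1) ?_
      intro s hs
      exact (e (T.model_mem hs)).imp (fun h => ⟨hs, h⟩) (fun h => ⟨hs, h⟩)
  | cf M hM φ ih =>
    refine or_congr_right ?_
    rw [ih, toGTeam_intervene]

/-- The member `a` supplies the function component, which an empty team would leave undetermined. -/
theorem exists_toGTeam_eq {U : GTeam σ} (hU : Uniform U) {a : Sem σ} (ha : a ∈ U) :
    ∃ T : CausalTeam σ, T.toGTeam = U := by
  have hmem : ∀ {s}, (∃ b ∈ U, b.1.1 = s) → a.1.2.Compatible s := by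
    rintro s ⟨b, hb, rfl⟩
    rw [hU a ha b hb]
    exact b.2.2
  refine ⟨⟨{s | ∃ b ∈ U, b.1.1 = s}, a.1.2, a.2.1, fun s hs => hmem hs⟩, ?_⟩
  ext c
  constructor
  · rintro ⟨⟨b, hb, e⟩, h⟩
    have : c = b := Subtype.ext (Prod.ext e.symm (h.trans (hU a ha b hb)))
    rwa [this]
  · exact fun hc => ⟨⟨c, hc, rfl⟩, hU c hc a ha⟩

end CausalTeam

/-! ### Soundness and completeness over causal teams. -/

theorem CDerives.sound {Γ : Set (COD σ)} {ψ : COD σ} (h : CDerives Γ ψ) : CEntails Γ ψ := by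
  intro T hT
  simp only [CausalTeam.sat_iff] at hT ⊢
  refine Derives.sound (K := {T | Uniform T}) ?_ ?_ ?_ h _ T.uniform_toGTeam hT
  · exact fun T hT S hS a ha b hb => hT a (hS ha) b (hS hb)
  · rintro T hT M _ ⟨a, ha, rfl⟩ _ ⟨b, hb, rfl⟩
    exact congrArg (fun F : Sys σ => F.restrict M) (hT a ha b hb)
  · rintro φ (rfl | rfl) T hT
    · exact gsat_oneFun_of_uniform hT
    · exact gsat_noMix_of_uniform hT

theorem CDerives.complete {Γ : Set (COD σ)} {ψ : COD σ} (h : CEntails Γ ψ) : CDerives Γ ψ := by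
  have hG : GEntails (Γ ∪ {oneFun σ, noMix σ}) ψ := by
    intro T hT
    obtain ⟨U, hU, hTU⟩ := exists_uniform (hT _ (.inr (.inl rfl))) (hT _ (.inr (.inr rfl)))
    rw [hTU]
    rcases U.eq_empty_or_nonempty with rfl | ⟨a, ha⟩
    · exact gsat_empty ψ
    · obtain ⟨S, rfl⟩ := CausalTeam.exists_toGTeam_eq hU ha
      rw [← CausalTeam.sat_iff]
      exact h S fun φ hφ => CausalTeam.sat_iff.2 ((hTU φ).1 (hT φ (.inl hφ)))
  refine Derives.cut ?_ ((GDerives.complete hG).mono (Set.empty_subset _) subset_rfl)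
  rintro φ (hφ | hφ)
  · exact .hyp hφ
  · exact .ax hφ

end CTeam

theorem mainTheorem9 (σ : CTeam.Signature.{u, v}) (Γ : Set (CTeam.COD σ)) (ψ : CTeam.COD σ) :
    (CTeam.GDerives Γ ψ ↔ CTeam.GEntails Γ ψ) ∧
      (CTeam.CDerives Γ ψ ↔ CTeam.CEntails Γ ψ) :=
  ⟨⟨CTeam.GDerives.sound, CTeam.GDerives.complete⟩,
    ⟨CTeam.CDerives.sound, CTeam.CDerives.complete⟩⟩
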